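/- **Setting.** Let $\|\cdot\|$ be an arbitrary norm on $\mathbb{R}^n$ with dual norm $\|\cdot\|_*$, let $X\subseteq\mathbb{R}^n$ be closed and convex, and consider $$\Psi^*=\min_{x\in X}\Big\{\Psi(x):=\sum_{i=1}^m f_i(x)+h(x)+\mu\,\omega(x)\Big\},\qquad \mu>0,$$ where $h:X\to\mathbb{R}$ is convex, $\omega:X\to\mathbb{R}$ is strongly convex with modulus $1$ with respect to $\|\cdot\|$, and the $f_i:\mathbb{R}^n\to\mathbb{R}$ are convex and differentiable with $\|\nabla f_i(x_1)-\nabla f_i(x_2)\|_*\le L_i\|x_1-x_2\|$ for all $x_1,x_2$, $L_i\ge 0$. Put $f=\sum_i f_i$ and $L=\sum_i L_i$, assume $L>0$, and let $0\le L_f\le L$ satisfy $\|\nabla f(x_1)-\nabla f(x_2)\|_*\le L_f\|x_1-x_2\|$ for all $x_1,x_2$. Let $x^*\in X$ be an optimal solution. For $x^0\in X$ and a chosen subgradient $\omega'(x^0)\in\partial\omega(x^0)$ let $P(x^0,x)=\omega(x)-\omega(x^0)-\langle\omega'(x^0),x-x^0\rangle$. Let $J_i(y)=\sup_x\{\langle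 x,y\rangle-f_i(x)\}$ with effective domain $\mathcal{Y}_i$, and $D_i(y^0,y)=J_i(y)-J_i(y^0)-\langle J_i'(y^0),y-y^0\rangle$, where $J_i'(y^0)\in\partial J_i(y^0)$ is a chosen subgradient. **RPDG with constant parameters $\tau,\eta,\alpha$ and probabilities $p_i$.** Start from $x^{-1}=x^0\in X$ with a subgradient $\omega'(x^0)$, $y_i^0=\nabla f_i(x^0)$ and $J_i'(y_i^0)=x^0$. For $t=1,2,\dots$ draw $i_t\in\{1,\dots,m\}$, independently of the past, with $\mathrm{Prob}\{i_t=i\}=p_i$, and set * $\tilde x^t=\alpha(x^{t-1}-x^{t-2})+x^{t-1}$; * for $i=i_t$: $y_i^t\in\arg\min_{y\in\mathcal{Y}_i}\{-\langle\tilde x^t,y\rangle+J_i(y)+\tau D_i(y_i^{t-1},y)\}$, $J_i'(y_i^t)=(\tilde x^t+\tau J_i'(y_i^{t-1}))/(1+\tau)$ and $\tilde y_i^t=p_i^{-1}(y_i^t-y_i^{t-1})+y_i^{t-1}$; for $i\ne i_t$: $y_i^t=\tilde y_i^t=y_i^{t-1}$ and $J_i'(y_i^t)=J_i'(y_i^{t-1})$;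 * $x^t\in\arg\min_{x\in X}\{\langle g^t,x\rangle+h(x)+\mu\,\omega(x)+\eta P(x^{t-1},x)\}$ with $g^t=\sum_{i=1}^m\tilde y_i^t$. The subgradient $\omega'(x^t)\in\partial\omega(x^t)$ that defines $P(x^t,\cdot)$ is chosen, depending only on $i_1,\dots,i_t$, so that for some $h'(x^t)\in\partial h(x^t)$ one has $\langle g^t+h'(x^t)+(\mu+\eta)\omega'(x^t)-\eta\,\omega'(x^{t-1}),\,x-x^t\rangle\ge 0$ for all $x\in X$. Subgradients of $h$ and $\omega$ are taken relative to $X$; it is assumed that these minimizers and selections exist along the run. **Statement.** Let $C=8L/\mu$ and $$p_i=\tfrac{1}{2m}+\tfrac{L_i}{2L},\quad \tau=\tfrac{\sqrt{(m-1)^2+4mC}-(m-1)}{2m},\quad \eta=\tfrac{\mu\sqrt{(m-1)^2+4mC}+\mu(m-1)}{2},\quad \alpha=1-\tfrac{1}{(m+1)+\sqrt{(m-1)^2+4mC}},$$ and let $\bar x^k=\big(\sum_{t=1}^k\alpha^{-t}\big)^{-1}\sum_{t=1}^k\alpha^{-t}x^t$. Then for every $k\ge1$ $$\mathbb{E}[P(x^k,x^*)]\le\Big(1+\tfrac{3L_f}{\mu}\Big)\alpha^kP(x^0,x^*),\qquad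 \mathbb{E}[\Psi(\bar x^k)-\Psi^*]\le\alpha^{k/2}(1-\alpha)^{-1}\Big[\mu+2L_f+\tfrac{L_f^2}{\mu}\Big]P(x^0,x^*).$$ Moreover, define, for $\epsilon>0$ (with the convention $\log 0=0$, relevant only if $P(x^0,x^*)=0$), $$K(\epsilon,C)=\big[(m+1)+\sqrt{(m-1)^2+4mC}\big]\log\Big[\big(1+\tfrac{3L_f}{\mu}\big)\tfrac{P(x^0,x^*)}{\epsilon}\Big],$$ $$\tilde K(\epsilon,C)=2\big[(m+1)+\sqrt{(m-1)^2+4mC}\big]\log\Big[2\big(\mu+2L_f+\tfrac{L_f^2}{\mu}\big)\big(m+\sqrt{mC}\big)\tfrac{P(x^0,x^*)}{\epsilon}\Big].$$ Then for all $\epsilon>0$ and $\lambda\in(0,1)$: * for every integer $k\ge0$ with $k\ge K(\epsilon,C)$, $x^k\in X$ and $\mathbb{E}[P(x^k,x^*)]\le\epsilon$ (a stochastic $\epsilon$-solution); for every integer $k\ge0$ with $k\ge K(\lambda\epsilon,C)$, $x^k\in X$ and $\mathrm{Prob}\{P(x^k,x^*)\le\epsilon\}\ge1-\lambda$ (a stochastic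 $(\epsilon,\lambda)$-solution); * for every integer $k\ge1$ with $k\ge\tilde K(\epsilon,C)$, $\bar x^k\in X$ and $\mathbb{E}[\Psi(\bar x^k)-\Psi^*]\le\epsilon$; for every integer $k\ge1$ with $k\ge\tilde K(\lambda\epsilon,C)$, $\bar x^k\in X$ and $\mathrm{Prob}\{\Psi(\bar x^k)-\Psi^*\le\epsilon\}\ge1-\lambda$. Both bounds are $O\big((m+\sqrt{mL/\mu})\log(1/\epsilon)\big)$ as $\epsilon\to0$ with an absolute constant: for all sufficiently small $\epsilon>0$ (depending on the problem data, on $x^0$ and on $\omega'(x^0)$), $K(\epsilon,C)\le12\,(m+\sqrt{mL/\mu})\log(1/\epsilon)$ and $\tilde K(\epsilon,C)\le24\,(m+\sqrt{mL/\mu})\log(1/\epsilon)$. -/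

import Mathlib

open MeasureTheory ProbabilityTheory Filter Topology

/-- Data of the problem `min_{x ∈ X} ∑ i, f i x + h x + mu * omega x` on a finite-dimensional real
normed space `E` (that is, `ℝⁿ` with an arbitrary norm). Linear functionals on `E`, in particular
gradients, live in `StrongDual ℝ E`, whose operator norm is the dual norm. -/
structure CompositeProblem (E : Type*) [NormedAddCommGroup E] [NormedSpace ℝ E] (m : ℕ) where
  X : Set E
  f : Fin m → E → ℝ
  h : E → ℝ
  omega : E → ℝ
  mu : ℝ

/-- `g` is a subgradient at `x` of the function `φ` with domain `X`. -/
def IsSubgradientWithin {E : Type*} [NormedAddCommGroup E] [NormedSpace ℝ E]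
    (X : Set E) (φ : E → ℝ) (x : E) (g : StrongDual ℝ E) : Prop :=
  ∀ u ∈ X, φ x + g (u - x) ≤ φ u

/-- The effective domain of the convex conjugate of `f`. -/
def conjDomain {E : Type*} [NormedAddCommGroup E] [NormedSpace ℝ E]
    (f : E → ℝ) : Set (StrongDual ℝ E) :=
  {y | BddAbove (Set.range fun x => y x - f x)}

/-- The convex conjugate `J y = sup_x (⟨x, y⟩ - f x)`, meaningful on `conjDomain f`. -/
noncomputable def conj {E : Type*} [NormedAddCommGroup E] [NormedSpace ℝ E]
    (f : E → ℝ) (y : StrongDual ℝ E) : ℝ :=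
  ⨆ x, (y x - f x)

/-- The dual prox-function `J y - [J y₀ + ⟨v₀, y - y₀⟩]`, where `v₀` is the chosen subgradient of the
conjugate `J` of `f` at `y₀`. -/
noncomputable def dualProxFun {E : Type*} [NormedAddCommGroup E] [NormedSpace ℝ E]
    (f : E → ℝ) (y₀ : StrongDual ℝ E) (v₀ : E) (y : StrongDual ℝ E) : ℝ :=
  conj f y - (conj f y₀ + (y - y₀) v₀)

/-- `y` is a value of the dual prox-mapping: it minimizes `-⟨xt, y⟩ + J y + τ D(y₀, y)` over the
domain of the conjugate `J` of `f`. -/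
def IsDualProx {E : Type*} [NormedAddCommGroup E] [NormedSpace ℝ E]
    (f : E → ℝ) (xt : E) (y₀ : StrongDual ℝ E) (v₀ : E) (τ : ℝ) (y : StrongDual ℝ E) : Prop :=
  y ∈ conjDomain f ∧
    IsMinOn (fun u => -(u xt) + conj f u + τ * dualProxFun f y₀ v₀ u) (conjDomain f) y

namespace CompositeProblem

variable {E : Type*} [NormedAddCommGroup E] [NormedSpace ℝ E] {m : ℕ}

/-- The smooth part `∑ i, f i x`. -/
def fsum (prob : CompositeProblem E m) (x : E) : ℝ := ∑ i, prob.f i x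

/-- The objective function. -/
def Psi (prob : CompositeProblem E m) (x : E) : ℝ := prob.fsum x + prob.h x + prob.mu * prob.omega x

/-- `xs` is an optimal solution. -/
def IsOptimal (prob : CompositeProblem E m) (xs : E) : Prop :=
  xs ∈ prob.X ∧ IsMinOn prob.Psi prob.X xs

/-- Standing assumptions: `L i` is a Lipschitz constant of the gradient of `f i`, and `Lf` one of the
gradient of the sum, with `Lf ≤ ∑ i, L i`. -/
structure Standing (prob : CompositeProblem E m) (L : Fin m → ℝ) (Lf : ℝ) : Prop where
  isClosed : IsClosed prob.X
  convex : Convex ℝ prob.X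
  convex_f : ∀ i, ConvexOn ℝ Set.univ (prob.f i)
  differentiable_f : ∀ i, Differentiable ℝ (prob.f i)
  L_nonneg : ∀ i, 0 ≤ L i
  lipschitz_f : ∀ i x₁ x₂, ‖fderiv ℝ (prob.f i) x₁ - fderiv ℝ (prob.f i) x₂‖ ≤ L i * ‖x₁ - x₂‖
  Lf_nonneg : 0 ≤ Lf
  lipschitz_fsum : ∀ x₁ x₂, ‖fderiv ℝ prob.fsum x₁ - fderiv ℝ prob.fsum x₂‖ ≤ Lf * ‖x₁ - x₂‖
  Lf_le : Lf ≤ ∑ i, L i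
  convex_h : ConvexOn ℝ prob.X prob.h
  strongConvex_omega : StrongConvexOn prob.X 1 prob.omega

/-- The primal prox-function `P(x₀, x) = ω x - [ω x₀ + ⟨w₀, x - x₀⟩]`, where `w₀` is the chosen
subgradient of `ω` at `x₀`. -/
def P (prob : CompositeProblem E m) (x₀ : E) (w₀ : StrongDual ℝ E) (x : E) : ℝ :=
  prob.omega x - (prob.omega x₀ + w₀ (x - x₀))

/-- `x` is a value of the primal prox-mapping: it minimizes
`⟨g, x⟩ + h x + μ ω x + η P(x₀, x)` over `X`. -/
def IsPrimalProx (prob : CompositeProblem E m) (g : StrongDual ℝ E) (x₀ : E) (w₀ : StrongDual ℝ E)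
    (η : ℝ) (x : E) : Prop :=
  x ∈ prob.X ∧
    IsMinOn (fun u => g u + prob.h u + prob.mu * prob.omega u + η * prob.P x₀ w₀ u) prob.X x

/-- `w` is an admissible choice of the subgradient of `ω` at the prox point `x`: together with some
subgradient `h'` of `h` at `x` it satisfies the optimality condition of the prox-mapping, i.e.
`-(g + h' + (μ + η) w - η w₀)` is in the normal cone of `X` at `x`. -/
def IsProxSelection (prob : CompositeProblem E m) (g w₀ : StrongDual ℝ E) (η : ℝ)
    (x : E) (w : StrongDual ℝ E) : Prop :=
  IsSubgradientWithin prob.X prob.omega x w ∧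
    ∃ h' : StrongDual ℝ E, IsSubgradientWithin prob.X prob.h x h' ∧
      ∀ u ∈ prob.X, 0 ≤ (g + h' + (prob.mu + η) • w - η • w₀) (u - x)

/-- `(x, w, xt, v, y, yt)` are the iterates of the randomized primal-dual gradient method driven by
the random indices `idx 1, idx 2, …` (`idx 0` is not used). Superscripts of the method are the
natural number arguments, `s` is the sample point. Here `w t` is the chosen subgradient of `ω` at
`x t`, and `v t i` the chosen subgradient of the conjugate of `f i` at `y t i`. -/
structure IsRPDG (prob : CompositeProblem E m) {Ω : Type*} (p : Fin m → ℝ) (τ η α : ℕ → ℝ)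
    (idx : ℕ → Ω → Fin m) (x₀ : E) (w₀ : StrongDual ℝ E)
    (x : ℕ → Ω → E) (w : ℕ → Ω → StrongDual ℝ E) (xt : ℕ → Ω → E)
    (v : ℕ → Fin m → Ω → E) (y yt : ℕ → Fin m → Ω → StrongDual ℝ E) : Prop where
  x_zero : ∀ s, x 0 s = x₀
  w_zero : ∀ s, w 0 s = w₀
  y_zero : ∀ i s, y 0 i s = fderiv ℝ (prob.f i) x₀
  v_zero : ∀ i s, v 0 i s = x₀
  /-- Primal prediction; for `t = 0` the truncated `t - 1` is `0`, which is the convention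
  `x^{-1} = x^0`. -/
  xt_succ : ∀ t s, xt (t + 1) s = α (t + 1) • (x t s - x (t - 1) s) + x t s
  y_succ : ∀ t s, IsDualProx (prob.f (idx (t + 1) s)) (xt (t + 1) s) (y t (idx (t + 1) s) s)
    (v t (idx (t + 1) s) s) (τ (t + 1)) (y (t + 1) (idx (t + 1) s) s)
  y_succ_of_ne : ∀ t s i, i ≠ idx (t + 1) s → y (t + 1) i s = y t i s
  v_succ : ∀ t s, v (t + 1) (idx (t + 1) s) s =
    (1 + τ (t + 1))⁻¹ • (xt (t + 1) s + τ (t + 1) • v t (idx (t + 1) s) s)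
  v_succ_of_ne : ∀ t s i, i ≠ idx (t + 1) s → v (t + 1) i s = v t i s
  yt_succ : ∀ t s, yt (t + 1) (idx (t + 1) s) s =
    (p (idx (t + 1) s))⁻¹ • (y (t + 1) (idx (t + 1) s) s - y t (idx (t + 1) s) s)
      + y t (idx (t + 1) s) s
  yt_succ_of_ne : ∀ t s i, i ≠ idx (t + 1) s → yt (t + 1) i s = y t i s
  x_succ : ∀ t s, prob.IsPrimalProx (∑ i, yt (t + 1) i s) (x t s) (w t s) (η (t + 1)) (x (t + 1) s)
  w_succ : ∀ t s, prob.IsProxSelection (∑ i, yt (t + 1) i s) (w t s) (η (t + 1)) (x (t + 1) s)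
    (w (t + 1) s)
  /-- The subgradient chosen at iteration `t` depends only on the indices drawn so far. -/
  w_nonanticipating : ∀ t s s', (∀ r, 1 ≤ r → r ≤ t → idx r s = idx r s') → w t s = w t s'

end CompositeProblem

/-- The indices `idx 1, idx 2, …` are independent with `Prob {idx t = j} = p j`. -/
structure IsIIDSampling {Ω : Type*} [MeasurableSpace Ω] {m : ℕ} (Pr : Measure Ω)
    (p : Fin m → ℝ) (idx : ℕ → Ω → Fin m) : Prop where
  measurable : ∀ t, 1 ≤ t → Measurable (idx t)
  indep : iIndepFun (fun t => idx (t + 1)) Pr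
  law : ∀ t, 1 ≤ t → ∀ j, Pr.real {s | idx t s = j} = p j

/-- The ergodic mean `(∑_{t=1}^k θ_t)⁻¹ ∑_{t=1}^k θ_t x^t` with `θ_t = 1 / α^t`. -/
noncomputable def ergodicMean {E : Type*} [NormedAddCommGroup E] [NormedSpace ℝ E] {Ω : Type*}
    (α : ℝ) (x : ℕ → Ω → E) (k : ℕ) (s : Ω) : E :=
  (∑ t ∈ Finset.Icc 1 k, 1 / α ^ t)⁻¹ • ∑ t ∈ Finset.Icc 1 k, (1 / α ^ t) • x t s

/-- The random point `z` of `X`, with accuracy measured by `gap`, is a stochastic `ε`-solution. -/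
def IsStochasticSolution {E : Type*} {Ω : Type*} [MeasurableSpace Ω] (Pr : Measure Ω) (X : Set E)
    (z : Ω → E) (gap : Ω → ℝ) (ε : ℝ) : Prop :=
  (∀ s, z s ∈ X) ∧ Integrable gap Pr ∧ ∫ s, gap s ∂Pr ≤ ε

/-- The random point `z` of `X`, with accuracy measured by `gap`, is a stochastic
`(ε, lam)`-solution. -/
def IsStochasticConfidenceSolution {E : Type*} {Ω : Type*} [MeasurableSpace Ω] (Pr : Measure Ω)
    (X : Set E) (z : Ω → E) (gap : Ω → ℝ) (ε lam : ℝ) : Prop :=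
  (∀ s, z s ∈ X) ∧ 1 - lam ≤ Pr.real {s | gap s ≤ ε}

/-- `√((m - 1)² + 4 m C)`. -/
noncomputable def rootTerm (m : ℕ) (C : ℝ) : ℝ := √(((m : ℝ) - 1) ^ 2 + 4 * m * C)

/-- Non-uniform sampling probabilities `1 / (2 m) + L_i / (2 L)`. -/
noncomputable def samplingProb {m : ℕ} (L : Fin m → ℝ) (i : Fin m) : ℝ :=
  1 / (2 * (m : ℝ)) + L i / (2 * ∑ j, L j)

noncomputable def stepTau (m : ℕ) (C : ℝ) : ℝ := (rootTerm m C - ((m : ℝ) - 1)) / (2 * m)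

noncomputable def stepEta (m : ℕ) (mu C : ℝ) : ℝ :=
  (mu * rootTerm m C + mu * ((m : ℝ) - 1)) / 2

noncomputable def stepAlpha (m : ℕ) (C : ℝ) : ℝ := 1 - 1 / (((m : ℝ) + 1) + rootTerm m C)

/-- The iteration bound `K(ε, C)`; `P₀` stands for `P(x^0, x^*)`. -/
noncomputable def iterBound (m : ℕ) (mu Lf P₀ ε C : ℝ) : ℝ :=
  (((m : ℝ) + 1) + rootTerm m C) * Real.log ((1 + 3 * Lf / mu) * (P₀ / ε))

/-- The iteration bound `K̃(ε, C)`; `P₀` stands for `P(x^0, x^*)`. -/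
noncomputable def iterBoundGap (m : ℕ) (mu Lf P₀ ε C : ℝ) : ℝ :=
  2 * (((m : ℝ) + 1) + rootTerm m C) *
    Real.log (2 * (mu + 2 * Lf + Lf ^ 2 / mu) * ((m : ℝ) + √(m * C)) * (P₀ / ε))

/-! The conjugates disappear at once: the optimality condition of the dual prox-step says that `y t
i` is the gradient of `f i` at `v t i`. The dual iterates are thus gradients at averaged points, and
every dual distance becomes a Bregman distance of some `f i`.

The proof then follows the potential V = `lyapunov`, made of weighted Bregman distances from `v i`
to `xs`, a cross term pairing the aggregated gradient error with the last primal displacement, a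
multiple of that displacement squared, and (μ + η) P. The primal three-point inequality, Young's
inequality and cocoercivity of the gradients give, along every path, gap + sampling term + V_{t+1} ≤
α V_t (`lyapunov_step`). The next index is independent of the past, and the importance weight 1 /
p_i makes the mean of the sampling term nonnegative (`sum_sampleTerm_nonneg`).

Dividing by powers of α and telescoping bounds both the weighted gaps and the last prox-distance by
V_0 (`expected_weighted_sum_le`), because V ≥ (μ + η) P (`le_lyapunov`). Here the gap is linearized
at `xs`, and by optimality it is nonnegative; so E P decays like α^k. The true gap exceeds the
linearized one by at most Lf P. In the ergodic mean these excesses add up to at most k times a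
constant, and k is at most α^{k/2} times the total weight (`natCast_le_mul_sum`). This is where the
rate α^{k/2} comes from. -/

/-! ### Bregman distances and the dual prox-step -/

section Bregman

variable {E : Type*} [NormedAddCommGroup E] [NormedSpace ℝ E]

/-- The Bregman distance `f a - f b - ⟨∇f b, a - b⟩`. -/
noncomputable def bregman (f : E → ℝ) (a b : E) : ℝ := f a - f b - fderiv ℝ f b (a - b)

lemma hasDerivAt_comp_segment {f : E → ℝ} (hd : Differentiable ℝ f) (b d : E) (t : ℝ) :
    HasDerivAt (fun t : ℝ => f (b + t • d)) (fderiv ℝ f (b + t • d) d) t := by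
  have h1 : HasDerivAt (fun t : ℝ => b + t • d) d t := by
    simpa using ((hasDerivAt_id t).smul_const d).const_add b
  exact (hd (b + t • d)).hasFDerivAt.comp_hasDerivAt t h1

lemma bregman_nonneg {f : E → ℝ} (hc : ConvexOn ℝ Set.univ f) (hd : Differentiable ℝ f) (a b : E) :
    0 ≤ bregman f a b := by
  have hconv : ConvexOn ℝ Set.univ (fun t : ℝ => f (b + t • (a - b))) := by
    have := hc.comp_affineMap (AffineMap.lineMap b a)
    simpa [Function.comp_def, AffineMap.lineMap_apply, add_comm] using this
  have h0 := hasDerivAt_comp_segment hd b (a - b) 0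
  have := hconv.le_slope_of_hasDerivAt (Set.mem_univ 0) (Set.mem_univ 1) one_pos h0
  simp [slope_def_field] at this
  unfold bregman
  simp
  linarith

/-- The descent lemma without integration: along the segment, the linearization error minus `t ^ 2 *
(K / 2 * ‖d‖ ^ 2)` has nonpositive derivative. -/
lemma bregman_le {f : E → ℝ} {K : ℝ} (hd : Differentiable ℝ f)
    (hl : ∀ x₁ x₂, ‖fderiv ℝ f x₁ - fderiv ℝ f x₂‖ ≤ K * ‖x₁ - x₂‖) (a b : E) :
    bregman f a b ≤ K / 2 * ‖a - b‖ ^ 2 := by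
  set d := a - b with hdd
  have hder : ∀ t : ℝ, HasDerivAt
      (fun t : ℝ => f (b + t • d) - t * fderiv ℝ f b d - t ^ 2 * (K / 2 * ‖d‖ ^ 2))
      (fderiv ℝ f (b + t • d) d - fderiv ℝ f b d - 2 * t * (K / 2 * ‖d‖ ^ 2)) t := by
    intro t
    have h2 : HasDerivAt (fun t : ℝ => t * fderiv ℝ f b d) (fderiv ℝ f b d) t := by
      simpa using (hasDerivAt_id t).mul_const (fderiv ℝ f b d)
    have h3 : HasDerivAt (fun t : ℝ => t ^ 2 * (K / 2 * ‖d‖ ^ 2)) (2 * t * (K / 2 * ‖d‖ ^ 2)) t := by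
      simpa using (hasDerivAt_pow 2 t).mul_const (K / 2 * ‖d‖ ^ 2)
    exact ((hasDerivAt_comp_segment hd b d t).sub h2).sub h3
  have hanti := antitoneOn_of_deriv_nonpos (convex_Icc (0 : ℝ) 1)
    (fun t _ => (hder t).continuousAt.continuousWithinAt)
    (fun t _ => (hder t).differentiableAt.differentiableWithinAt)
    (fun t ht => by
      rw [interior_Icc] at ht
      rw [(hder t).deriv]
      have h1 : (fderiv ℝ f (b + t • d) - fderiv ℝ f b) d ≤ K * ‖t • d‖ * ‖d‖ :=
        (le_abs_self _).trans <| (ContinuousLinearMap.le_opNorm _ d).trans <|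
          mul_le_mul_of_nonneg_right (by simpa using hl (b + t • d) b) (norm_nonneg d)
      rw [norm_smul, Real.norm_of_nonneg ht.1.le, sub_apply] at h1
      linarith)
  have := hanti (Set.left_mem_Icc.2 zero_le_one) (Set.right_mem_Icc.2 zero_le_one) zero_le_one
  simp only [one_smul, one_mul, zero_smul, zero_mul, add_zero, one_pow, ne_eq, OfNat.ofNat_ne_zero,
    not_false_eq_true, zero_pow, sub_zero] at this
  have hb : b + d = a := by simp [hdd]
  rw [hb] at this
  unfold bregman
  linarith

/-- Cocoercivity in an arbitrary norm. Comparing the descent lemma at `a - d` with convexity at `b`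
gives `g d ≤ D + K / 2 * ‖d‖ ^ 2`. Replacing `d` by `t • d` yields a nonnegative quadratic in `t`,
whose discriminant bounds `g d` and hence the dual norm. -/
lemma sq_norm_fderiv_sub_le {f : E → ℝ} {K : ℝ} (hc : ConvexOn ℝ Set.univ f)
    (hd : Differentiable ℝ f) (hK : 0 ≤ K)
    (hl : ∀ x₁ x₂, ‖fderiv ℝ f x₁ - fderiv ℝ f x₂‖ ≤ K * ‖x₁ - x₂‖) (a b : E) :
    ‖fderiv ℝ f a - fderiv ℝ f b‖ ^ 2 ≤ 2 * K * bregman f a b := by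
  set D := bregman f a b with hD
  set g := fderiv ℝ f a - fderiv ℝ f b with hg
  have hD0 : 0 ≤ D := bregman_nonneg hc hd a b
  have key : ∀ d : E, g d ≤ D + K / 2 * ‖d‖ ^ 2 := by
    intro d
    have h1 := bregman_le hd hl (a - d) a
    have h2 := bregman_nonneg hc hd (a - d) b
    have e1 : a - d - a = -d := by abel
    have e2 : a - d - b = (a - b) - d := by abel
    unfold bregman at h1 h2
    rw [e1, norm_neg, map_neg] at h1
    rw [e2, map_sub] at h2
    rw [hD, hg, sub_apply]
    unfold bregman
    linarith
  have hsq : ∀ d : E, g d ≤ √(2 * K * D) * ‖d‖ := by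
    intro d
    have hquad : ∀ t : ℝ, 0 ≤ (K / 2 * ‖d‖ ^ 2) * (t * t) + (-g d) * t + D := by
      intro t
      have := key (t • d)
      rw [map_smul, norm_smul, mul_pow, Real.norm_eq_abs, sq_abs, smul_eq_mul] at this
      nlinarith
    have := discrim_le_zero hquad
    unfold discrim at this
    rw [← Real.sqrt_sq (norm_nonneg d), ← Real.sqrt_mul (by positivity)]
    apply Real.le_sqrt_of_sq_le
    nlinarith
  have hn : ‖g‖ ≤ √(2 * K * D) := by
    refine ContinuousLinearMap.opNorm_le_bound _ (Real.sqrt_nonneg _) fun d => ?_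
    rw [Real.norm_eq_abs, abs_le']
    refine ⟨hsq d, ?_⟩
    have := hsq (-d)
    rwa [map_neg, norm_neg] at this
  calc ‖g‖ ^ 2 ≤ √(2 * K * D) ^ 2 := by gcongr
    _ = _ := Real.sq_sqrt (by positivity)

lemma eq_fderiv_of_isSubgradient {f : E → ℝ} {z : E} {y : StrongDual ℝ E}
    (hd : DifferentiableAt ℝ f z) (hy : ∀ u, f z + y (u - z) ≤ f u) : y = fderiv ℝ f z := by
  have hmin : IsLocalMin (fun u => f u - y u) z := by
    refine Filter.Eventually.of_forall fun u => ?_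
    have := hy u
    rw [map_sub] at this
    linarith
  have h := hmin.hasFDerivAt_eq_zero (hd.hasFDerivAt.sub y.hasFDerivAt)
  exact (sub_eq_zero.1 h).symm

/-- The gradient belongs to the domain of the conjugate, where Fenchel's inequality is tight. -/
lemma conj_fderiv {f : E → ℝ} (hc : ConvexOn ℝ Set.univ f) (hd : Differentiable ℝ f) (z : E) :
    fderiv ℝ f z ∈ conjDomain f ∧ conj f (fderiv ℝ f z) = fderiv ℝ f z z - f z := by
  have hub : ∀ x, fderiv ℝ f z x - f x ≤ fderiv ℝ f z z - f z := by
    intro x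
    have := bregman_nonneg hc hd x z
    unfold bregman at this
    rw [map_sub] at this
    linarith
  have hbdd : fderiv ℝ f z ∈ conjDomain f := ⟨_, by rintro _ ⟨x, rfl⟩; exact hub x⟩
  exact ⟨hbdd, le_antisymm (ciSup_le hub) (le_ciSup hbdd z)⟩

/-- The dual prox-mapping is a gradient evaluation. -/
lemma IsDualProx.eq_fderiv {f : E → ℝ} (hc : ConvexOn ℝ Set.univ f) (hd : Differentiable ℝ f)
    {xt : E} {y₀ : StrongDual ℝ E} {v₀ : E} {τ : ℝ} (hτ : 0 ≤ τ) {y : StrongDual ℝ E}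
    (h : IsDualProx f xt y₀ v₀ τ y) : y = fderiv ℝ f ((1 + τ)⁻¹ • (xt + τ • v₀)) := by
  obtain ⟨hy, hmin⟩ := h
  set z := (1 + τ)⁻¹ • (xt + τ • v₀) with hz
  have hz' : xt + τ • v₀ = (1 + τ) • z := by
    rw [hz, smul_smul, mul_inv_cancel₀ (by positivity), one_smul]
  have happ : ∀ u : StrongDual ℝ E, u xt + τ * u v₀ = (1 + τ) * u z := by
    intro u
    have := congrArg u hz'
    simpa using this
  -- Up to a constant the prox objective is (1 + τ)(J u - ⟨z, u⟩). Testing minimality against the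
  -- gradient at `z`, where Fenchel's inequality is tight, makes it tight for `y` as well, so `y` is
  -- a subgradient of `f` at `z`.
  obtain ⟨hg, hconj⟩ := conj_fderiv hc hd z
  have hle := hmin hg
  simp only [Set.mem_ofPred_eq, dualProxFun, sub_apply] at hle
  have h1 : conj f y ≤ y z - f z := by
    have e1 := happ y
    have e2 := happ (fderiv ℝ f z)
    rw [hconj] at hle
    have : (1 + τ) * (conj f y - y z) ≤ (1 + τ) * (-f z) := by linarith
    have := le_of_mul_le_mul_left this (by positivity)
    linarith
  refine eq_fderiv_of_isSubgradient (hd z) fun u => ?_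
  have h2 : y u - f u ≤ conj f y := le_ciSup (f := fun x => y x - f x) hy u
  rw [map_sub]
  linarith

end Bregman

/-! ### Primal prox-function, linearized gap and three-point inequality -/

namespace CompositeProblem

variable {E : Type*} [NormedAddCommGroup E] [NormedSpace ℝ E] {m : ℕ}
  {prob : CompositeProblem E m} {L : Fin m → ℝ} {Lf : ℝ}

lemma Standing.differentiable_fsum (hprob : prob.Standing L Lf) : Differentiable ℝ prob.fsum := by
  unfold fsum
  exact Differentiable.fun_sum fun i _ => hprob.differentiable_f i

lemma Standing.fderiv_fsum (hprob : prob.Standing L Lf) (z : E) :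
    fderiv ℝ prob.fsum z = ∑ i, fderiv ℝ (prob.f i) z := by
  unfold fsum
  exact fderiv_fun_sum fun i _ => hprob.differentiable_f i z

lemma Standing.convex_fsum (hprob : prob.Standing L Lf) : ConvexOn ℝ Set.univ prob.fsum := by
  have : prob.fsum = ∑ i, prob.f i := by
    ext z; simp [fsum]
  rw [this]
  exact Finset.sum_induction _ (ConvexOn ℝ Set.univ) (fun _ _ => ConvexOn.add)
    (convexOn_const 0 convex_univ) fun i _ => hprob.convex_f i

lemma Standing.bregman_fsum (hprob : prob.Standing L Lf) (a b : E) :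
    bregman prob.fsum a b = ∑ i, bregman (prob.f i) a b := by
  simp [bregman, hprob.fderiv_fsum, fsum]

lemma Standing.convex_Phi (hprob : prob.Standing L Lf) (hmu : 0 < prob.mu) :
    ConvexOn ℝ prob.X (fun u => prob.h u + prob.mu * prob.omega u) := by
  have h1 : ConvexOn ℝ prob.X prob.omega :=
    (strongConvexOn_zero.1 (hprob.strongConvex_omega.mono zero_le_one))
  exact hprob.convex_h.add (h1.smul hmu.le)

/-- The prox-function dominates half the squared distance. -/
lemma Standing.half_sq_le_P (hprob : prob.Standing L Lf) {a u : E} {wa : StrongDual ℝ E}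
    (ha : a ∈ prob.X) (hu : u ∈ prob.X) (hw : IsSubgradientWithin prob.X prob.omega a wa) :
    ‖u - a‖ ^ 2 / 2 ≤ prob.P a wa u := by
  -- Strong convexity and the subgradient inequality, both at `(1 - t) • a + t • u`, divided by `t`;
  -- then `t` tends to 0.
  have key : ∀ t : ℝ, 0 < t → t < 1 → (1 - t) * (‖u - a‖ ^ 2 / 2) ≤ prob.P a wa u := by
    intro t h0 h1
    have hsc := hprob.strongConvex_omega.2 ha hu (sub_nonneg.2 h1.le) h0.le (by ring)
    have hmem : (1 - t) • a + t • u ∈ prob.X :=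
      hprob.convex ha hu (sub_nonneg.2 h1.le) h0.le (by ring)
    have hs := hw _ hmem
    have e : (1 - t) • a + t • u - a = t • (u - a) := by module
    rw [e, map_smul, smul_eq_mul] at hs
    simp only [smul_eq_mul] at hsc
    rw [norm_sub_rev a u] at hsc
    unfold P
    have : t * ((1 - t) * (‖u - a‖ ^ 2 / 2)) ≤
        t * (prob.omega u - (prob.omega a + wa (u - a))) := by
      nlinarith
    exact le_of_mul_le_mul_left this h0
  have hlim : Tendsto (fun t : ℝ => (1 - t) * (‖u - a‖ ^ 2 / 2)) (𝓝[>] 0)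
      (𝓝 ((1 - 0) * (‖u - a‖ ^ 2 / 2))) := by
    refine (Continuous.tendsto ?_ 0).mono_left nhdsWithin_le_nhds
    fun_prop
  rw [sub_zero, one_mul] at hlim
  refine le_of_tendsto hlim ?_
  filter_upwards [Ioo_mem_nhdsGT (zero_lt_one' ℝ)] with t ht
  exact key t ht.1 ht.2

lemma P_nonneg {a u : E} {wa : StrongDual ℝ E}
    (hu : u ∈ prob.X) (hw : IsSubgradientWithin prob.X prob.omega a wa) :
    0 ≤ prob.P a wa u := by
  have := hw u hu
  unfold P
  linarith

/-- First-order optimality gap: the value at `u` of the objective linearized in its smooth part at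
`xs`, relative to `xs`. -/
noncomputable def linGap (prob : CompositeProblem E m) (xs u : E) : ℝ :=
  prob.h u + prob.mu * prob.omega u - (prob.h xs + prob.mu * prob.omega xs)
    + fderiv ℝ prob.fsum xs (u - xs)

/-- Moving from `xs` a fraction `t` towards `u` cannot decrease the objective, while the smooth part
deviates from its linearization by O(t²). Divide by `t` and let `t` tend to 0. -/
lemma Standing.linGap_nonneg (hprob : prob.Standing L Lf) (hmu : 0 < prob.mu) {xs u : E}
    (hxs : prob.IsOptimal xs) (hu : u ∈ prob.X) : 0 ≤ prob.linGap xs u := by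
  have key : ∀ t : ℝ, 0 < t → t < 1 →
      0 ≤ prob.linGap xs u + t * (Lf / 2 * ‖u - xs‖ ^ 2) := by
    intro t h0 h1
    have hmem : (1 - t) • xs + t • u ∈ prob.X :=
      hprob.convex hxs.1 hu (sub_nonneg.2 h1.le) h0.le (by ring)
    have hconv := (hprob.convex_Phi hmu).2 hxs.1 hu (sub_nonneg.2 h1.le) h0.le (by ring)
    have hopt := hxs.2 hmem
    have hb := bregman_le hprob.differentiable_fsum hprob.lipschitz_fsum
      ((1 - t) • xs + t • u) xs
    have e : (1 - t) • xs + t • u - xs = t • (u - xs) := by module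
    unfold bregman at hb
    rw [e, map_smul, norm_smul, mul_pow, Real.norm_eq_abs, sq_abs, smul_eq_mul] at hb
    simp only [Set.mem_ofPred_eq, Psi] at hopt
    simp only [smul_eq_mul] at hconv
    unfold linGap
    have : 0 ≤ t * (prob.h u + prob.mu * prob.omega u - (prob.h xs + prob.mu * prob.omega xs)
        + fderiv ℝ prob.fsum xs (u - xs) + t * (Lf / 2 * ‖u - xs‖ ^ 2)) := by
      nlinarith
    exact nonneg_of_mul_nonneg_right this h0
  have hlim : Tendsto (fun t : ℝ => prob.linGap xs u + t * (Lf / 2 * ‖u - xs‖ ^ 2)) (𝓝[>] 0)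
      (𝓝 (prob.linGap xs u + 0 * (Lf / 2 * ‖u - xs‖ ^ 2))) := by
    refine (Continuous.tendsto ?_ 0).mono_left nhdsWithin_le_nhds
    fun_prop
  rw [zero_mul, add_zero] at hlim
  refine ge_of_tendsto hlim ?_
  filter_upwards [Ioo_mem_nhdsGT (zero_lt_one' ℝ)] with t ht
  exact key t ht.1 ht.2

lemma Standing.convexOn_linGap (hprob : prob.Standing L Lf) (hmu : 0 < prob.mu) (xs : E) :
    ConvexOn ℝ prob.X (prob.linGap xs) := by
  have h1 : ConvexOn ℝ prob.X (fun u => fderiv ℝ prob.fsum xs u) :=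
    (LinearMap.convexOn (fderiv ℝ prob.fsum xs).toLinearMap hprob.convex)
  have h2 := ((hprob.convex_Phi hmu).add h1).add_const
    (-(prob.h xs + prob.mu * prob.omega xs) - fderiv ℝ prob.fsum xs xs)
  refine h2.congr fun u _ => ?_
  simp [linGap]
  ring

lemma Standing.Psi_sub_le (hprob : prob.Standing L Lf) (xs u : E) :
    prob.Psi u - prob.Psi xs ≤ prob.linGap xs u + Lf / 2 * ‖u - xs‖ ^ 2 := by
  have := bregman_le hprob.differentiable_fsum hprob.lipschitz_fsum u xs
  unfold bregman at this
  unfold Psi linGap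
  linarith

/-- The three-point inequality of the primal prox-mapping. -/
lemma IsProxSelection.three_point {g w₀ wx : StrongDual ℝ E} {η : ℝ} {x₀ x u : E}
    (hsel : prob.IsProxSelection g w₀ η x wx) (hu : u ∈ prob.X) :
    g (x - u) + prob.h x + prob.mu * prob.omega x + (prob.mu + η) * prob.P x wx u
      + η * prob.P x₀ w₀ x ≤ prob.h u + prob.mu * prob.omega u + η * prob.P x₀ w₀ u := by
  obtain ⟨hw, h', hh', hopt⟩ := hsel
  have h1 := hopt u hu
  have h2 := hh' u hu
  simp only [add_apply, sub_apply,
    smul_apply, smul_eq_mul] at h1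
  unfold P
  simp only [map_sub] at *
  linarith

end CompositeProblem

/-! ### Lyapunov function: one-step decrease and lower bound -/

section Lyapunov

variable {E : Type*} [NormedAddCommGroup E] [NormedSpace ℝ E] {m : ℕ}

/-- The weighted Bregman distance of the dual iterates to the dual solution. -/
noncomputable def dualPotential (f : Fin m → E → ℝ) (p : Fin m → ℝ) (τ : ℝ) (xs : E)
    (v : Fin m → E) : ℝ :=
  ∑ j, (1 + τ) / p j * bregman (f j) (v j) xs

/-- The distance `∑ j, (∇f_j (v_j) - ∇f_j (xs))` of the aggregated dual iterate to the dual
solution. -/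
noncomputable def dualResidual (f : Fin m → E → ℝ) (xs : E) (v : Fin m → E) : StrongDual ℝ E :=
  ∑ j, (fderiv ℝ (f j) (v j) - fderiv ℝ (f j) xs)

/-- The Lyapunov function of the method; `Δ` is the last primal displacement and `P` the primal
prox-distance to the solution. -/
noncomputable def lyapunov (f : Fin m → E → ℝ) (p : Fin m → ℝ) (τ η mu : ℝ) (xs : E)
    (v : Fin m → E) (Δ : E) (P : ℝ) : ℝ :=
  dualPotential f p τ xs v + dualResidual f xs v Δ + η / 4 * ‖Δ‖ ^ 2 + (mu + η) * P

/-- The contribution of sampling the index `j`; its mean is nonnegative. -/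
noncomputable def sampleTerm (f : Fin m → E → ℝ) (p : Fin m → ℝ) (τ α : ℝ) (xs xt : E)
    (v : Fin m → E) (j : Fin m) (z : E) : ℝ :=
  dualResidual f xs v (xt - xs) - (1 - α) * dualPotential f p τ xs v +
    (p j)⁻¹ * ((fderiv ℝ (f j) z - fderiv ℝ (f j) (v j)) (xt - xs)
      - (1 + τ) * (bregman (f j) z xs - bregman (f j) (v j) xs) - τ * bregman (f j) (v j) z)

lemma young_of_sq_le {a b c d : ℝ} (hc : 0 ≤ c) (hd : 0 ≤ d)
    (h : (a * b) ^ 2 ≤ 4 * (c * d)) : a * b ≤ c + d := by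
  refine le_of_sq_le_sq ?_ (add_nonneg hc hd)
  nlinarith [sq_nonneg (c - d)]

variable {f : Fin m → E → ℝ} {p L : Fin m → ℝ} {τ η α mu : ℝ}

/-- The four-point identity behind the dual prox-step. -/
lemma fderiv_sub_apply_eq (φ : E → ℝ) {τ : ℝ} (hτ : 0 ≤ τ) (xs xt v : E) {z : E}
    (hz : z = (1 + τ)⁻¹ • (xt + τ • v)) :
    (fderiv ℝ φ z - fderiv ℝ φ xs) (xt - xs) =
      bregman φ xs z + (1 + τ) * bregman φ z xs + τ * bregman φ v z - τ * bregman φ v xs := by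
  have hxt : xt = (1 + τ) • z - τ • v := by
    rw [hz, smul_smul, mul_inv_cancel₀ (by positivity), one_smul]
    abel
  rw [hxt]
  simp only [bregman, sub_apply, map_sub, map_smul, smul_eq_mul]
  ring

/-- The weights `p j` cancel the factors `(p j)⁻¹`. By the four-point identity each summand is then
`bregman (f j) xs (z j)` plus (1 - (1 - α)(1 + τ) / p_j) times `bregman (f j) (v j) xs`; `hα` makes
the second coefficient nonnegative. -/
lemma sum_sampleTerm_nonneg (hconv : ∀ j, ConvexOn ℝ Set.univ (f j))
    (hdiff : ∀ j, Differentiable ℝ (f j)) (hp : ∀ j, 0 < p j) (hp1 : ∑ j, p j = 1) (hτ : 0 ≤ τ)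
    (hα : ∀ j, (1 - α) * (1 + τ) ≤ p j) (xs xt : E) (v : Fin m → E) :
    0 ≤ ∑ j, p j * sampleTerm f p τ α xs xt v j ((1 + τ)⁻¹ • (xt + τ • v j)) := by
  set z : Fin m → E := fun j => (1 + τ)⁻¹ • (xt + τ • v j) with hz
  have e : ∑ j, p j * sampleTerm f p τ α xs xt v j (z j) =
      ∑ j, ((fderiv ℝ (f j) (v j) - fderiv ℝ (f j) xs) (xt - xs)
        - (1 - α) * ((1 + τ) / p j * bregman (f j) (v j) xs)
        + ((fderiv ℝ (f j) (z j) - fderiv ℝ (f j) (v j)) (xt - xs)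
        - (1 + τ) * (bregman (f j) (z j) xs - bregman (f j) (v j) xs)
          - τ * bregman (f j) (v j) (z j))) := by
    simp only [sampleTerm, mul_add, Finset.sum_add_distrib]
    rw [← Finset.sum_mul, hp1, one_mul]
    congr 1
    · rw [Finset.sum_sub_distrib, ← Finset.mul_sum, dualPotential, dualResidual, sum_apply]
    · refine Finset.sum_congr rfl fun j _ => ?_
      rw [← mul_assoc, mul_inv_cancel₀ (hp j).ne', one_mul]
  rw [e]
  refine Finset.sum_nonneg fun j _ => ?_
  have h1 := fderiv_sub_apply_eq (f j) hτ xs xt (v j) (z := z j) rfl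
  have h2 := bregman_nonneg (hconv j) (hdiff j) xs (z j)
  have h3 := bregman_nonneg (hconv j) (hdiff j) (v j) xs
  have h4 : (1 - α) * ((1 + τ) / p j * bregman (f j) (v j) xs) ≤ bregman (f j) (v j) xs := by
    rw [← mul_assoc, mul_div_assoc']
    exact mul_le_of_le_one_left h3 ((div_le_one (hp j)).2 (hα j))
  simp only [sub_apply] at h1 ⊢
  linarith

/-- The sampling term is designed to cancel the change of the dual potential and everything paired
with `xt - xs`. What remains are two products of `δ` with the displacements `x' - x` and `Δ`; each
is absorbed by half of the term `τ * bregman (f i) (v i) z` and by η / 4 times a squared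
displacement. -/
lemma lyapunov_step (hconv : ∀ j, ConvexOn ℝ Set.univ (f j)) (hdiff : ∀ j, Differentiable ℝ (f j))
    (hL : ∀ j, 0 ≤ L j)
    (hlip : ∀ j x₁ x₂, ‖fderiv ℝ (f j) x₁ - fderiv ℝ (f j) x₂‖ ≤ L j * ‖x₁ - x₂‖)
    (hp : ∀ j, 0 < p j) (hp1 : ∀ j, p j ≤ 1) (hτ : 0 ≤ τ) (hη : 0 ≤ η) (hα0 : 0 ≤ α) (hα1 : α ≤ 1)
    (hpL : ∀ j, 4 * L j ≤ η * τ * p j) (hηα : η ≤ α * (mu + η))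
    {xs x x' xt Δ z : E} {v v' : Fin m → E} {i : Fin m} {A P P' : ℝ} (hP : 0 ≤ P)
    (hxt : xt = α • Δ + x) (hvi : v' i = z) (hv : ∀ j, j ≠ i → v' j = v j)
    (hprimal : A + dualResidual f xs v (x' - xs)
      + (p i)⁻¹ * (fderiv ℝ (f i) z - fderiv ℝ (f i) (v i)) (x' - xs)
      ≤ η * P - (mu + η) * P' - η * (‖x' - x‖ ^ 2 / 2)) :
    A + sampleTerm f p τ α xs xt v i z + lyapunov f p τ η mu xs v' (x' - x) P'
      ≤ α * lyapunov f p τ η mu xs v Δ P := by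
  set δ := fderiv ℝ (f i) z - fderiv ℝ (f i) (v i) with hδ
  have hpi := hp i
  have hpinv : 1 ≤ (p i)⁻¹ := (one_le_inv₀ hpi).2 (hp1 i)
  have hpot : dualPotential f p τ xs v' = dualPotential f p τ xs v
      + (1 + τ) * ((p i)⁻¹ * (bregman (f i) z xs - bregman (f i) (v i) xs)) := by
    unfold dualPotential
    rw [← Finset.add_sum_erase _ _ (Finset.mem_univ i),
      ← Finset.add_sum_erase (a := i) _ (fun j => (1 + τ) / p j * bregman (f j) (v j) xs)
        (Finset.mem_univ i), hvi, Finset.sum_congr rfl fun j hj => by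
        rw [hv j (Finset.ne_of_mem_erase hj)]]
    ring
  have hres : dualResidual f xs v' = dualResidual f xs v + δ := by
    unfold dualResidual
    rw [← Finset.add_sum_erase _ _ (Finset.mem_univ i),
      ← Finset.add_sum_erase (a := i) _ (fun j => fderiv ℝ (f j) (v j) - fderiv ℝ (f j) xs)
        (Finset.mem_univ i), hvi, Finset.sum_congr rfl fun j hj => by
        rw [hv j (Finset.ne_of_mem_erase hj)], hδ]
    abel
  have hB := bregman_nonneg (hconv i) (hdiff i) (v i) z
  have hδsq : ‖δ‖ ^ 2 ≤ 2 * L i * bregman (f i) (v i) z := by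
    rw [hδ, norm_sub_rev]
    exact sq_norm_fderiv_sub_le (hconv i) (hdiff i) (hL i) (hlip i) _ _
  -- The condition `4 * L i ≤ η * τ * p i` is exactly what this use of Young's inequality requires,
  -- given cocoercivity.
  have hyoung : ∀ d : E, (p i)⁻¹ * ‖δ‖ * ‖d‖ ≤
      (p i)⁻¹ * (τ * bregman (f i) (v i) z / 2) + η / 4 * ‖d‖ ^ 2 := by
    intro d
    refine young_of_sq_le (by positivity) (by positivity) ?_
    have h1 : (p i)⁻¹ * (2 * L i * bregman (f i) (v i) z) ≤
        η * τ / 2 * bregman (f i) (v i) z := by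
      rw [inv_mul_le_iff₀ hpi]
      have := mul_le_mul_of_nonneg_right (hpL i) hB
      linarith
    have h2 : (p i)⁻¹ * ‖δ‖ ^ 2 ≤ η * τ / 2 * bregman (f i) (v i) z :=
      (mul_le_mul_of_nonneg_left hδsq (by positivity)).trans h1
    calc ((p i)⁻¹ * ‖δ‖ * ‖d‖) ^ 2 = ((p i)⁻¹ * ‖d‖ ^ 2) * ((p i)⁻¹ * ‖δ‖ ^ 2) := by ring
      _ ≤ ((p i)⁻¹ * ‖d‖ ^ 2) * (η * τ / 2 * bregman (f i) (v i) z) := by gcongr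
      _ = _ := by ring
  have habs : ∀ d : E, |δ d| ≤ ‖δ‖ * ‖d‖ := fun d => δ.le_opNorm d
  -- The coefficient is `(p i)⁻¹ - 1` because one copy of `δ (x' - x)` belongs to the new residual.
  have hc1 : -(((p i)⁻¹ - 1) * δ (x' - x)) ≤
      (p i)⁻¹ * (τ * bregman (f i) (v i) z / 2) + η / 4 * ‖x' - x‖ ^ 2 := by
    refine le_trans ?_ (hyoung (x' - x))
    have h1 : ((p i)⁻¹ - 1) * -δ (x' - x) ≤ ((p i)⁻¹ - 1) * (‖δ‖ * ‖x' - x‖) :=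
      mul_le_mul_of_nonneg_left ((neg_le_abs _).trans (habs _)) (by linarith)
    have h2 : 0 ≤ ‖δ‖ * ‖x' - x‖ := by positivity
    linarith
  have hc2 : α * ((p i)⁻¹ * δ Δ) ≤
      (p i)⁻¹ * (τ * bregman (f i) (v i) z / 2) + α * (η / 4 * ‖Δ‖ ^ 2) := by
    have h1 : (p i)⁻¹ * δ Δ ≤ (p i)⁻¹ * (‖δ‖ * ‖Δ‖) :=
      mul_le_mul_of_nonneg_left ((le_abs_self _).trans (habs _)) (by positivity)
    have h2 := mul_le_mul_of_nonneg_left (h1.trans_eq (mul_assoc _ _ _).symm |>.trans (hyoung Δ)) hα0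
    have h3 : α * ((p i)⁻¹ * (τ * bregman (f i) (v i) z / 2)) ≤
        (p i)⁻¹ * (τ * bregman (f i) (v i) z / 2) := mul_le_of_le_one_left (by positivity) hα1
    linarith
  have hP' := mul_le_mul_of_nonneg_right hηα hP
  -- The extrapolation makes the old cross term appear with factor α, so that the cross terms
  -- telescope.
  have hsplit : x' - xs = (x' - x) - α • Δ + (xt - xs) := by
    rw [hxt]; abel
  rw [hsplit] at hprimal
  simp only [map_add, map_sub (_ : StrongDual ℝ E) (x' - x), map_smul, smul_eq_mul] at hprimal
  unfold lyapunov sampleTerm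
  rw [hpot, hres, add_apply, ← hδ]
  nlinarith

/-- The cross term is harmless: distribute `η / 4 * ‖Δ‖ ^ 2` over the components in proportion to `p
j` and apply Young's inequality to each. -/
lemma le_lyapunov (hconv : ∀ j, ConvexOn ℝ Set.univ (f j)) (hdiff : ∀ j, Differentiable ℝ (f j))
    (hL : ∀ j, 0 ≤ L j)
    (hlip : ∀ j x₁ x₂, ‖fderiv ℝ (f j) x₁ - fderiv ℝ (f j) x₂‖ ≤ L j * ‖x₁ - x₂‖)
    (hp : ∀ j, 0 < p j) (hp1 : ∑ j, p j = 1) (hτ : 0 ≤ τ) (hη : 0 ≤ η)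
    (hpL : ∀ j, 4 * L j ≤ η * τ * p j) (xs : E) (v : Fin m → E) (Δ : E) (P : ℝ) :
    (mu + η) * P ≤ lyapunov f p τ η mu xs v Δ P := by
  have hple : ∀ j, p j ≤ 1 := fun j =>
    hp1 ▸ Finset.single_le_sum (fun j _ => (hp j).le) (Finset.mem_univ j)
  have hterm : ∀ j, 0 ≤ (1 + τ) / p j * bregman (f j) (v j) xs
      + (fderiv ℝ (f j) (v j) - fderiv ℝ (f j) xs) Δ + p j * (η / 4 * ‖Δ‖ ^ 2) := by
    intro j
    set B := bregman (f j) (v j) xs with hBdef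
    set δ := fderiv ℝ (f j) (v j) - fderiv ℝ (f j) xs with hδ
    have hB : 0 ≤ B := bregman_nonneg (hconv j) (hdiff j) (v j) xs
    have hpj := hp j
    have hδsq : ‖δ‖ ^ 2 ≤ 2 * L j * B :=
      sq_norm_fderiv_sub_le (hconv j) (hdiff j) (hL j) (hlip j) _ _
    have hyoung : ‖δ‖ * ‖Δ‖ ≤ τ * B / 2 + p j * (η / 4 * ‖Δ‖ ^ 2) := by
      refine young_of_sq_le (by positivity) (by positivity) ?_
      have := mul_le_mul_of_nonneg_right (hpL j) hB
      calc (‖δ‖ * ‖Δ‖) ^ 2 = ‖δ‖ ^ 2 * ‖Δ‖ ^ 2 := by ring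
        _ ≤ (η * τ * p j / 2 * B) * ‖Δ‖ ^ 2 := by gcongr; linarith
        _ = _ := by ring
    have h1 : τ * B / 2 ≤ (1 + τ) / p j * B := by
      have h2 : 1 + τ ≤ (1 + τ) / p j := le_div_self (by positivity) hpj (hple j)
      have h3 := mul_le_mul_of_nonneg_right h2 hB
      have h4 : 0 ≤ τ * B := by positivity
      linarith
    have h5 := (neg_le_abs _).trans (δ.le_opNorm Δ)
    linarith
  have := Finset.sum_nonneg fun j (_ : j ∈ Finset.univ) => hterm j
  rw [Finset.sum_add_distrib, Finset.sum_add_distrib, ← Finset.sum_mul, hp1, one_mul] at this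
  unfold lyapunov dualPotential dualResidual
  rw [sum_apply]
  linarith

end Lyapunov

/-! ### Functions of the draws, averaging over the next index, Markov's inequality -/

section Sampling

variable {Ω : Type*} {m : ℕ} {idx : ℕ → Ω → Fin m}

/-- `F` is a function of the indices drawn in the first `t` iterations. -/
def DependsOnDraws {β : Type*} (idx : ℕ → Ω → Fin m) (t : ℕ) (F : Ω → β) : Prop :=
  ∀ s s', (∀ r, 1 ≤ r → r ≤ t → idx r s = idx r s') → F s = F s'

/-- The indices drawn in the first `t` iterations. -/
def drawHistory (idx : ℕ → Ω → Fin m) (t : ℕ) (s : Ω) (r : Finset.range t) : Fin m :=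
  idx (r + 1) s

lemma DependsOnDraws.mono {β : Type*} {F : Ω → β} {t t' : ℕ} (h : DependsOnDraws idx t F)
    (htt : t ≤ t') : DependsOnDraws idx t' F :=
  fun s s' hs => h s s' fun r h1 h2 => hs r h1 (h2.trans htt)

lemma DependsOnDraws.exists_factor {F : Ω → ℝ} {t : ℕ} (h : DependsOnDraws idx t F) :
    ∃ g : (Finset.range t → Fin m) → ℝ, F = g ∘ drawHistory idx t := by
  have hf : Function.FactorsThrough F (drawHistory idx t) := by
    intro s s' hs
    refine h s s' fun r h1 h2 => ?_
    have := congrFun hs ⟨r - 1, Finset.mem_range.2 (by omega)⟩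
    simpa [drawHistory, Nat.sub_add_cancel h1] using this
  exact ⟨Function.extend (drawHistory idx t) F 0, funext fun s => (hf.extend_apply 0 s).symm⟩

variable [MeasurableSpace Ω] {Pr : Measure Ω} {p : Fin m → ℝ}

lemma IsIIDSampling.measurable_drawHistory (hidx : IsIIDSampling Pr p idx) (t : ℕ) :
    Measurable (drawHistory idx t) :=
  measurable_pi_lambda _ fun r => hidx.measurable (r + 1) (by omega)

/-- Factoring through a finite type of histories settles measurability and integrability together.
-/
lemma DependsOnDraws.integrable [IsFiniteMeasure Pr] (hidx : IsIIDSampling Pr p idx)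
    {F : Ω → ℝ} {t : ℕ} (h : DependsOnDraws idx t F) : Integrable F Pr := by
  obtain ⟨g, rfl⟩ := h.exists_factor
  have : Integrable g (Pr.map (drawHistory idx t)) := Integrable.of_finite
  exact this.comp_measurable (hidx.measurable_drawHistory t)

/-- The next index is independent of the past, so it can be averaged out. -/
lemma IsIIDSampling.integral_sampled [IsProbabilityMeasure Pr] (hidx : IsIIDSampling Pr p idx)
    {t : ℕ} {G : Fin m → Ω → ℝ} (hG : ∀ j, DependsOnDraws idx t (G j)) :
    ∫ s, G (idx (t + 1) s) s ∂Pr = ∫ s, ∑ j, p j * G j s ∂Pr := by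
  have hint : ∀ j, Integrable (G j) Pr := fun j => (hG j).integrable hidx
  have hind : ∀ j, ∫ s, G j s * (if idx (t + 1) s = j then 1 else 0) ∂Pr = p j * ∫ s, G j s ∂Pr := by
    intro j
    obtain ⟨g, hg⟩ := (hG j).exists_factor
    -- The independent family is shifted by one: the history occupies the coordinates below `t`, and
    -- the next draw `idx (t + 1)` is coordinate `t`.
    have h1 := hidx.indep.indepFun_finset (Finset.range t) {t} (by simp)
      fun r => hidx.measurable (r + 1) (by omega)
    have h2 : IndepFun (G j) (fun s => if idx (t + 1) s = j then (1 : ℝ) else 0) Pr := by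
      rw [hg]
      exact h1.comp (φ := g)
        (ψ := fun q : (({t} : Finset ℕ) → Fin m) =>
          if q ⟨t, Finset.mem_singleton_self t⟩ = j then (1 : ℝ) else 0)
        (measurable_of_finite _) (measurable_of_finite _)
    have hmeas : Measurable (fun s => if idx (t + 1) s = j then (1 : ℝ) else 0) :=
      (measurable_of_finite (fun i : Fin m => if i = j then (1 : ℝ) else 0)).comp
        (hidx.measurable (t + 1) (by omega))
    have h3 := h2.integral_fun_mul_eq_mul_integral (hint j).aestronglyMeasurable
      hmeas.aestronglyMeasurable
    have h4 : ∫ s, (if idx (t + 1) s = j then (1 : ℝ) else 0) ∂Pr = p j := by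
      have hset : MeasurableSet {s | idx (t + 1) s = j} :=
        hidx.measurable (t + 1) (by omega) (measurableSet_singleton j)
      rw [← hidx.law (t + 1) (by omega) j, ← integral_indicator_one hset]
      exact integral_congr_ae (Eventually.of_forall fun s => by simp [Set.indicator])
    rw [h3, h4, mul_comm]
  have hint' : ∀ j, Integrable (fun s => G j s * (if idx (t + 1) s = j then 1 else 0)) Pr := by
    intro j
    have : DependsOnDraws idx (t + 1) fun s => G j s * (if idx (t + 1) s = j then 1 else 0) := by
      intro s s' hs
      simp only
      rw [(hG j).mono t.le_succ s s' hs, hs (t + 1) (by omega) le_rfl]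
    exact this.integrable hidx
  calc ∫ s, G (idx (t + 1) s) s ∂Pr
      = ∫ s, ∑ j, G j s * (if idx (t + 1) s = j then 1 else 0) ∂Pr := by simp
    _ = ∑ j, p j * ∫ s, G j s ∂Pr := by
      rw [integral_finsetSum _ fun j _ => hint' j]
      exact Finset.sum_congr rfl fun j _ => hind j
    _ = _ := by
      rw [integral_finsetSum _ fun j _ => (hint j).const_mul (p j)]
      simp only [integral_const_mul]

/-- Markov's inequality for a nonnegative accuracy measure. -/
lemma IsStochasticSolution.confidence {E : Type*} [IsProbabilityMeasure Pr] {X : Set E} {z : Ω → E}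
    {gap : Ω → ℝ} {ε lam : ℝ} (hε : 0 < ε) (hgap : ∀ s, 0 ≤ gap s)
    (h : IsStochasticSolution Pr X z gap (lam * ε)) :
    IsStochasticConfidenceSolution Pr X z gap ε lam := by
  refine ⟨h.1, ?_⟩
  have h1 := mul_meas_ge_le_integral_of_nonneg (Eventually.of_forall hgap) h.2.1 ε
  have h2 : Pr.real {s | ε ≤ gap s} ≤ lam :=
    le_of_mul_le_mul_left (by linarith [h.2.2]) hε
  -- A covering by two sets suffices, since subadditivity needs no measurability.
  have h3 : (Set.univ : Set Ω) ⊆ {s | gap s ≤ ε} ∪ {s | ε ≤ gap s} := fun s _ => le_total (gap s) ε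
  have h4 := (measureReal_mono (μ := Pr) h3).trans (measureReal_union_le _ _)
  rw [probReal_univ] at h4
  linarith

end Sampling

/-! ### Algebra of the step sizes -/

section Stepsizes

variable {m : ℕ} {C mu : ℝ}

lemma sq_rootTerm (hC : 0 ≤ C) : rootTerm m C ^ 2 = ((m : ℝ) - 1) ^ 2 + 4 * m * C :=
  Real.sq_sqrt (by positivity)

lemma lt_rootTerm (hm : 1 ≤ m) (hC : 0 < C) : (m : ℝ) - 1 < rootTerm m C := by
  have hm' : (1 : ℝ) ≤ m := by exact_mod_cast hm
  exact Real.lt_sqrt_of_sq_lt (by nlinarith)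

lemma rootTerm_le (hm : 1 ≤ m) (hC : 0 ≤ C) : rootTerm m C ≤ (m - 1) + 2 * √(m * C) := by
  have hm' : (1 : ℝ) ≤ m := by exact_mod_cast hm
  have h1 := Real.sqrt_nonneg (m * C)
  refine Real.sqrt_le_iff.2 ⟨by linarith, ?_⟩
  have h2 := Real.sq_sqrt (show 0 ≤ m * C by positivity)
  nlinarith [mul_nonneg (sub_nonneg.2 hm') h1]

lemma stepTau_pos (hm : 1 ≤ m) (hC : 0 < C) : 0 < stepTau m C := by
  have hm' : (1 : ℝ) ≤ m := by exact_mod_cast hm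
  exact div_pos (sub_pos.2 (lt_rootTerm hm hC)) (by positivity)

lemma stepEta_pos (hm : 1 ≤ m) (hC : 0 < C) (hmu : 0 < mu) : 0 < stepEta m mu C := by
  have hm' : (1 : ℝ) ≤ m := by exact_mod_cast hm
  have := lt_rootTerm hm hC
  have h : 0 < mu * (rootTerm m C + (m - 1)) := mul_pos hmu (by linarith)
  unfold stepEta
  linarith

lemma stepEta_mul_stepTau (hm : 1 ≤ m) (hC : 0 < C) : stepEta m mu C * stepTau m C = mu * C := by
  have hm' : (1 : ℝ) ≤ m := by exact_mod_cast hm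
  have := sq_rootTerm (m := m) hC.le
  unfold stepEta stepTau
  field_simp
  linear_combination mu * this

lemma one_sub_stepAlpha : 1 - stepAlpha m C = 1 / ((m + 1) + rootTerm m C) := by
  simp [stepAlpha]

lemma one_sub_stepAlpha_pos : 0 < 1 - stepAlpha m C := by
  have := Real.sqrt_nonneg (((m : ℝ) - 1) ^ 2 + 4 * m * C)
  rw [one_sub_stepAlpha, rootTerm]
  positivity

lemma one_sub_stepAlpha_le (hm : 1 ≤ m) : 1 - stepAlpha m C ≤ 1 / 2 := by
  have hm' : (1 : ℝ) ≤ m := by exact_mod_cast hm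
  have h : 0 ≤ rootTerm m C := Real.sqrt_nonneg _
  rw [one_sub_stepAlpha]
  exact one_div_le_one_div_of_le two_pos (by linarith)

/-- With S = m + 1 + `rootTerm m C`, one has 1 - α = 1 / S and 1 + τ = S / (2m); likewise μ + η = μ
S / 2. -/
lemma one_sub_stepAlpha_mul_tau (hm : 1 ≤ m) :
    (1 - stepAlpha m C) * (1 + stepTau m C) = 1 / (2 * m) := by
  have hm' : (1 : ℝ) ≤ m := by exact_mod_cast hm
  have h : 0 ≤ rootTerm m C := Real.sqrt_nonneg _
  have h' : (0 : ℝ) < m + 1 + rootTerm m C := by positivity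
  rw [one_sub_stepAlpha, stepTau]
  field_simp
  ring

lemma one_sub_stepAlpha_mul_eta :
    (1 - stepAlpha m C) * (mu + stepEta m mu C) = mu / 2 := by
  have h : 0 ≤ rootTerm m C := Real.sqrt_nonneg _
  have h' : (0 : ℝ) < m + 1 + rootTerm m C := by positivity
  rw [one_sub_stepAlpha, stepEta]
  field_simp
  ring

variable {L : Fin m → ℝ}

/-- The uniform half of the probability gives (1 - α)(1 + τ) ≤ p_i; the half proportional to `L i`
gives 4 L_i ≤ η τ p_i. -/
lemma samplingProb_ge (hL : ∀ j, 0 ≤ L j) (i : Fin m) :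
    1 / (2 * (m : ℝ)) ≤ samplingProb L i := by
  have := Finset.sum_nonneg fun j (_ : j ∈ Finset.univ) => hL j
  exact le_add_of_nonneg_right (div_nonneg (hL i) (by positivity))

lemma div_le_samplingProb (i : Fin m) : L i / (2 * ∑ j, L j) ≤ samplingProb L i :=
  le_add_of_nonneg_left (by positivity)

lemma sum_samplingProb (hm : 1 ≤ m) (hL : 0 < ∑ j, L j) : ∑ i, samplingProb L i = 1 := by
  have hm' : (1 : ℝ) ≤ m := by exact_mod_cast hm
  have h1 : ∑ i, L i / (2 * ∑ j, L j) = 1 / 2 := by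
    rw [← Finset.sum_div]
    field_simp
  unfold samplingProb
  rw [Finset.sum_add_distrib, h1, Finset.sum_const, Finset.card_univ, Fintype.card_fin,
    nsmul_eq_mul]
  field_simp
  norm_num

end Stepsizes

/-! ### Structure of the iterates and their dependence on the draws -/

namespace CompositeProblem.IsRPDG

variable {E : Type*} [NormedAddCommGroup E] [NormedSpace ℝ E] {m : ℕ}
  {prob : CompositeProblem E m} {L : Fin m → ℝ} {Lf : ℝ}
  {Ω : Type*} {p : Fin m → ℝ} {τ η α : ℝ} {idx : ℕ → Ω → Fin m} {x₀ : E} {w₀ : StrongDual ℝ E}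
  {x : ℕ → Ω → E} {w : ℕ → Ω → StrongDual ℝ E} {xt : ℕ → Ω → E}
  {v : ℕ → Fin m → Ω → E} {y yt : ℕ → Fin m → Ω → StrongDual ℝ E}

lemma y_eq (hrun : prob.IsRPDG p (fun _ => τ) (fun _ => η) (fun _ => α) idx x₀ w₀ x w xt v y yt)
    (hprob : prob.Standing L Lf) (hτ : 0 ≤ τ) (t : ℕ) (i : Fin m) (s : Ω) :
    y t i s = fderiv ℝ (prob.f i) (v t i s) := by
  induction t generalizing i with
  | zero => rw [hrun.y_zero, hrun.v_zero]
  | succ t ih =>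
    by_cases hi : i = idx (t + 1) s
    · have := (hrun.y_succ t s).eq_fderiv (hprob.convex_f _) (hprob.differentiable_f _) hτ
      rw [hi, this, hrun.v_succ]
    · rw [hrun.y_succ_of_ne t s i hi, hrun.v_succ_of_ne t s i hi, ih]

lemma x_mem (hrun : prob.IsRPDG p (fun _ => τ) (fun _ => η) (fun _ => α) idx x₀ w₀ x w xt v y yt)
    (hx₀ : x₀ ∈ prob.X) (t : ℕ) (s : Ω) : x t s ∈ prob.X := by
  cases t with
  | zero => rwa [hrun.x_zero]
  | succ t => exact (hrun.x_succ t s).1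

lemma w_sub (hrun : prob.IsRPDG p (fun _ => τ) (fun _ => η) (fun _ => α) idx x₀ w₀ x w xt v y yt)
    (hw₀ : IsSubgradientWithin prob.X prob.omega x₀ w₀) (t : ℕ) (s : Ω) :
    IsSubgradientWithin prob.X prob.omega (x t s) (w t s) := by
  cases t with
  | zero => rwa [hrun.x_zero, hrun.w_zero]
  | succ t => exact (hrun.w_succ t s).1

lemma sum_yt (hrun : prob.IsRPDG p (fun _ => τ) (fun _ => η) (fun _ => α) idx x₀ w₀ x w xt v y yt)
    (hprob : prob.Standing L Lf) (hτ : 0 ≤ τ) (t : ℕ) (s : Ω) :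
    ∑ i, yt (t + 1) i s = ∑ i, fderiv ℝ (prob.f i) (v t i s)
      + (p (idx (t + 1) s))⁻¹ • (fderiv ℝ (prob.f (idx (t + 1) s)) (v (t + 1) (idx (t + 1) s) s)
        - fderiv ℝ (prob.f (idx (t + 1) s)) (v t (idx (t + 1) s) s)) := by
  rw [← Finset.add_sum_erase _ _ (Finset.mem_univ (idx (t + 1) s)),
    ← Finset.add_sum_erase (a := idx (t + 1) s) _ (fun i => fderiv ℝ (prob.f i) (v t i s))
      (Finset.mem_univ _), hrun.yt_succ, hrun.y_eq hprob hτ, hrun.y_eq hprob hτ,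
    Finset.sum_congr rfl fun j hj => by
      rw [hrun.yt_succ_of_ne t s j (Finset.ne_of_mem_erase hj), hrun.y_eq hprob hτ]]
  abel

/-- The prox point is unique. -/
lemma prox_unique (hprob : prob.Standing L Lf) (hmu : 0 < prob.mu + η) {g w₀ wx : StrongDual ℝ E}
    {x₀ x x' : E} (hx : prob.IsPrimalProx g x₀ w₀ η x) (hx' : prob.IsPrimalProx g x₀ w₀ η x')
    (hsel : prob.IsProxSelection g w₀ η x wx) : x = x' := by
  have h1 := hsel.three_point (x₀ := x₀) hx'.1
  have h2 := hx'.2 hx.1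
  have h3 := hprob.half_sq_le_P hx.1 hx'.1 hsel.1
  simp only [Set.mem_ofPred_eq] at h2
  rw [map_sub] at h1
  have h4 : (prob.mu + η) * prob.P x wx x' ≤ 0 := by linarith
  have h5 : prob.P x wx x' ≤ 0 := nonpos_of_mul_nonpos_right h4 hmu
  have h6 : ‖x' - x‖ = 0 := by
    have := sq_nonneg ‖x' - x‖
    exact pow_eq_zero_iff two_ne_zero |>.1 (by linarith)
  exact (sub_eq_zero.1 (norm_eq_zero.1 h6)).symm

/-- The iterates are functions of the drawn indices. -/
lemma dependsOnDraws
    (hrun : prob.IsRPDG p (fun _ => τ) (fun _ => η) (fun _ => α) idx x₀ w₀ x w xt v y yt)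
    (hprob : prob.Standing L Lf) (hτ : 0 ≤ τ) (hmu : 0 < prob.mu + η) (t : ℕ) :
    DependsOnDraws idx t (x t) ∧ ∀ i, DependsOnDraws idx t (v t i) := by
  -- Extrapolation at step `t + 1` also involves `x (t - 1)`, hence strong induction.
  induction t using Nat.strong_induction_on with
  | _ t ih =>
    cases t with
    | zero =>
      exact ⟨fun s s' _ => by rw [hrun.x_zero, hrun.x_zero],
        fun i s s' _ => by rw [hrun.v_zero, hrun.v_zero]⟩
    | succ t =>
      have hx := (ih t t.lt_succ_self).1
      have hv := (ih t t.lt_succ_self).2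
      have hx' := (ih (t - 1) (by omega)).1.mono (Nat.sub_le t 1)
      have hall : ∀ s s', (∀ r, 1 ≤ r → r ≤ t + 1 → idx r s = idx r s') →
          (∀ i, v (t + 1) i s = v (t + 1) i s') ∧ x (t + 1) s = x (t + 1) s' := by
        intro s s' hs
        have hs' : ∀ r, 1 ≤ r → r ≤ t → idx r s = idx r s' :=
          fun r h1 h2 => hs r h1 (h2.trans t.le_succ)
        have hi := hs (t + 1) (by omega) le_rfl
        have hvv : ∀ i, v (t + 1) i s = v (t + 1) i s' := by
          intro i
          by_cases h : i = idx (t + 1) s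
          · have h1 := hrun.v_succ t s
            have h2 := hrun.v_succ t s'
            rw [hrun.xt_succ] at h1 h2
            rw [← hi] at h2
            rw [h, h1, h2, hx s s' hs', hx' s s' hs', hv _ s s' hs']
          · rw [hrun.v_succ_of_ne t s i h, hrun.v_succ_of_ne t s' i (hi ▸ h), hv i s s' hs']
        refine ⟨hvv, ?_⟩
        have hg : ∑ i, yt (t + 1) i s = ∑ i, yt (t + 1) i s' := by
          rw [hrun.sum_yt hprob hτ, hrun.sum_yt hprob hτ, ← hi, hvv, hv _ s s' hs',
            Finset.sum_congr rfl fun i _ => by rw [hv i s s' hs']]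
        have hp' := hrun.x_succ t s'
        rw [← hg, ← hx s s' hs', ← hrun.w_nonanticipating t s s' hs'] at hp'
        exact prox_unique hprob hmu (hrun.x_succ t s) hp' (hrun.w_succ t s)
      exact ⟨fun s s' hs => (hall s s' hs).2, fun i s s' hs => (hall s s' hs).1 i⟩

end CompositeProblem.IsRPDG

/-! ### Pathwise decrease along a run -/

namespace CompositeProblem.IsRPDG

variable {E : Type*} [NormedAddCommGroup E] [NormedSpace ℝ E] {m : ℕ}
  {prob : CompositeProblem E m} {L : Fin m → ℝ} {Lf : ℝ}
  {Ω : Type*} {p : Fin m → ℝ} {τ η α : ℝ} {idx : ℕ → Ω → Fin m} {x₀ : E} {w₀ : StrongDual ℝ E}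
  {x : ℕ → Ω → E} {w : ℕ → Ω → StrongDual ℝ E} {xt : ℕ → Ω → E}
  {v : ℕ → Fin m → Ω → E} {y yt : ℕ → Fin m → Ω → StrongDual ℝ E}

/-- One iteration decreases the Lyapunov function, up to the sampling term. -/
lemma pathwise_step
    (hrun : prob.IsRPDG p (fun _ => τ) (fun _ => η) (fun _ => α) idx x₀ w₀ x w xt v y yt)
    (hprob : prob.Standing L Lf) (hx₀ : x₀ ∈ prob.X)
    (hw₀ : IsSubgradientWithin prob.X prob.omega x₀ w₀) (hp : ∀ j, 0 < p j) (hp1 : ∀ j, p j ≤ 1)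
    (hτ : 0 ≤ τ) (hη : 0 ≤ η) (hα0 : 0 ≤ α) (hα1 : α ≤ 1)
    (hpL : ∀ j, 4 * L j ≤ η * τ * p j) (hηα : η ≤ α * (prob.mu + η))
    {xs : E} (hxs : xs ∈ prob.X) (t : ℕ) (s : Ω) :
    prob.linGap xs (x (t + 1) s)
      + sampleTerm prob.f p τ α xs (xt (t + 1) s) (fun j => v t j s) (idx (t + 1) s)
        ((1 + τ)⁻¹ • (xt (t + 1) s + τ • v t (idx (t + 1) s) s))
      + lyapunov prob.f p τ η prob.mu xs (fun j => v (t + 1) j s) (x (t + 1) s - x t s)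
        (prob.P (x (t + 1) s) (w (t + 1) s) xs)
      ≤ α * lyapunov prob.f p τ η prob.mu xs (fun j => v t j s) (x t s - x (t - 1) s)
        (prob.P (x t s) (w t s) xs) := by
  have hv := hrun.v_succ t s
  refine lyapunov_step hprob.convex_f hprob.differentiable_f hprob.L_nonneg hprob.lipschitz_f hp hp1
    hτ hη hα0 hα1 hpL hηα (P_nonneg hxs (hrun.w_sub hw₀ t s)) (hrun.xt_succ t s) hv
    (fun j hj => hrun.v_succ_of_ne t s j hj) ?_
  have h1 := (hrun.w_succ t s).three_point (x₀ := x t s) hxs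
  have h2 := mul_le_mul_of_nonneg_left
    (hprob.half_sq_le_P (hrun.x_mem hx₀ t s) (hrun.x_mem hx₀ (t + 1) s) (hrun.w_sub hw₀ t s)) hη
  rw [hrun.sum_yt hprob hτ, hv] at h1
  -- The gradient at `xs` contained in the linearized gap turns the aggregated gradient into the
  -- residual.
  unfold linGap dualResidual
  rw [hprob.fderiv_fsum, Finset.sum_sub_distrib, sub_apply]
  rw [add_apply, smul_apply, smul_eq_mul] at h1
  linarith

end CompositeProblem.IsRPDG

/-! ### Scalar inequalities -/

section Scalars

lemma weighted_sum_add_le {a u : ℕ → ℝ} {α : ℝ} (hα : 0 < α)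
    (h : ∀ t, a (t + 1) + u (t + 1) ≤ α * u t) (k : ℕ) :
    ∑ t ∈ Finset.Icc 1 k, 1 / α ^ t * a t + 1 / α ^ k * u k ≤ u 0 := by
  induction k with
  | zero => simp
  | succ k ih =>
    rw [Finset.sum_Icc_succ_top (by omega)]
    have h1 : 1 / α ^ (k + 1) * (a (k + 1) + u (k + 1)) ≤ 1 / α ^ (k + 1) * (α * u k) :=
      mul_le_mul_of_nonneg_left (h k) (by positivity)
    have h2 : 1 / α ^ (k + 1) * (α * u k) = 1 / α ^ k * u k := by
      field_simp
      ring
    linarith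

/-- Pair each weight with its mirror image. Their product is α^{-(k+1)}, so by the
arithmetic-geometric mean inequality each pair sums to at least 2 α^{-k/2}. -/
lemma natCast_le_mul_sum {α : ℝ} (h0 : 0 < α) (h1 : α ≤ 1) (k : ℕ) :
    (k : ℝ) ≤ α ^ ((k : ℝ) / 2) * ∑ t ∈ Finset.Icc 1 k, 1 / α ^ t := by
  set r := α ^ ((k : ℝ) / 2) with hr
  have hr0 : 0 < r := Real.rpow_pos_of_pos h0 _
  have hr2 : r ^ 2 = α ^ k := by
    rw [hr, ← Real.rpow_natCast, ← Real.rpow_mul h0.le, ← Real.rpow_natCast]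
    congr 1
    push_cast
    ring
  have hpair : ∀ t ∈ Finset.range k, 2 ≤ r * (1 / α ^ (1 + t) + 1 / α ^ (1 + (k - 1 - t))) := by
    intro t ht
    have ht' := Finset.mem_range.1 ht
    set a := 1 / α ^ (1 + t)
    set b := 1 / α ^ (1 + (k - 1 - t))
    have ha : 0 < a := by positivity
    have hb : 0 < b := by positivity
    have hab : 1 ≤ r ^ 2 * (a * b) := by
      have e : (1 + t) + (1 + (k - 1 - t)) = k + 1 := by omega
      have e2 : r ^ 2 * (a * b) = 1 / α := by
        simp only [a, b]
        rw [div_mul_div_comm, ← pow_add, e, hr2, pow_succ]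
        field_simp
      rw [e2]
      exact (one_le_div h0).2 h1
    have hnn : 0 ≤ r * (a + b) := by positivity
    refine le_of_sq_le_sq ?_ hnn
    nlinarith [mul_nonneg (sq_nonneg r) (sq_nonneg (a - b))]
  have hsum : ∑ t ∈ Finset.Icc 1 k, 1 / α ^ t = ∑ t ∈ Finset.range k, 1 / α ^ (1 + t) := by
    rw [← Finset.Ico_add_one_right_eq_Icc, Finset.sum_Ico_eq_sum_range]
    simp
  have hrefl := Finset.sum_range_reflect (fun t => 1 / α ^ (1 + t)) k
  have h2 := Finset.sum_le_sum hpair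
  rw [← Finset.mul_sum, Finset.sum_add_distrib, hrefl, ← hsum] at h2
  simp at h2
  simp
  linarith

/-- Uses 1 - 1 / S ≤ exp(-1 / S). The exponent is real so that `k / 2` is allowed; `P = 0` is
separate because the logarithm then carries no information. -/
lemma pow_mul_le_of_log_le {S c P ε : ℝ} {a : ℝ} (hS : 0 < S) (ha : 0 ≤ a) (haS : a ≤ 1 - 1 / S)
    (hc : 0 < c) (hP : 0 ≤ P) (hε : 0 < ε) {q : ℝ} (hq : 0 ≤ q)
    (hk : S * Real.log (c * (P / ε)) ≤ q) : c * a ^ q * P ≤ ε := by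
  rcases hP.eq_or_lt with rfl | hP
  · simpa using hε.le
  have h1 : a ^ q ≤ Real.exp (-(q / S)) := by
    have h2 : a ≤ Real.exp (-(1 / S)) := haS.trans (by
      have := Real.add_one_le_exp (-(1 / S)); linarith)
    calc a ^ q ≤ Real.exp (-(1 / S)) ^ q := Real.rpow_le_rpow ha h2 hq
      _ = Real.exp (-(q / S)) := by rw [← Real.exp_mul]; congr 1; ring
  have hpos : 0 < c * (P / ε) := by positivity
  have h3 : Real.log (c * (P / ε)) ≤ q / S := by
    rw [le_div_iff₀ hS]; linarith
  have h4 : c * (P / ε) ≤ Real.exp (q / S) := (Real.log_le_iff_le_exp hpos).1 h3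
  have h5 : c * P ≤ ε * Real.exp (q / S) := by
    have := mul_le_mul_of_nonneg_left h4 hε.le
    calc c * P = ε * (c * (P / ε)) := by field_simp
      _ ≤ _ := this
  calc c * a ^ q * P = a ^ q * (c * P) := by ring
    _ ≤ Real.exp (-(q / S)) * (ε * Real.exp (q / S)) := by gcongr
    _ = ε := by rw [Real.exp_neg]; field_simp

/-- Once c P ≤ 1 / ε, the constant costs at most a second log(1 / ε); hence the factor 2 in `hSB`.
-/
lemma eventually_mul_log_le {S B c P : ℝ} (hS : 0 ≤ S) (hSB : 2 * S ≤ B) (hc : 0 < c) (hP : 0 ≤ P) :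
    ∀ᶠ ε in 𝓝[>] (0 : ℝ), S * Real.log (c * (P / ε)) ≤ B * Real.log (1 / ε) := by
  have hev : ∀ᶠ ε in 𝓝[>] (0 : ℝ), ε ∈ Set.Ioo 0 (min 1 (1 / (c * P + 1))) :=
    Ioo_mem_nhdsGT (by positivity)
  filter_upwards [hev] with ε hε
  obtain ⟨h0, h1⟩ := hε
  have hlog : 0 ≤ Real.log (1 / ε) :=
    Real.log_nonneg ((one_le_div h0).2 (h1.le.trans (min_le_left _ _)))
  rcases hP.eq_or_lt with rfl | hP
  · simpa using mul_nonneg (by linarith : 0 ≤ B) hlog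
  have h2 : Real.log (c * (P / ε)) ≤ 2 * Real.log (1 / ε) := by
    have e : c * (P / ε) = (c * P) * (1 / ε) := by ring
    rw [e, Real.log_mul (by positivity) (by positivity)]
    have h3 : c * P ≤ 1 / ε := by
      rw [le_div_iff₀ h0]
      have h4 := h1.trans_le (min_le_right _ _)
      rw [lt_div_iff₀ (by positivity)] at h4
      linarith
    have := Real.log_le_log (by positivity) h3
    linarith
  calc S * Real.log (c * (P / ε)) ≤ S * (2 * Real.log (1 / ε)) := by gcongr
    _ = 2 * S * Real.log (1 / ε) := by ring
    _ ≤ _ := by gcongr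

end Scalars

/-! ### Initial value of the Lyapunov function and the master inequality -/

namespace CompositeProblem.IsRPDG

variable {E : Type*} [NormedAddCommGroup E] [NormedSpace ℝ E] {m : ℕ}
  {prob : CompositeProblem E m} {L : Fin m → ℝ} {Lf : ℝ}
  {Ω : Type*} {p : Fin m → ℝ} {τ η α : ℝ} {idx : ℕ → Ω → Fin m} {x₀ : E} {w₀ : StrongDual ℝ E}
  {x : ℕ → Ω → E} {w : ℕ → Ω → StrongDual ℝ E} {xt : ℕ → Ω → E}
  {v : ℕ → Fin m → Ω → E} {y yt : ℕ → Fin m → Ω → StrongDual ℝ E}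

lemma dependsOnDraws_P
    (hrun : prob.IsRPDG p (fun _ => τ) (fun _ => η) (fun _ => α) idx x₀ w₀ x w xt v y yt)
    (hprob : prob.Standing L Lf) (hτ : 0 ≤ τ) (hmu : 0 < prob.mu + η) (xs : E) (t : ℕ) :
    DependsOnDraws idx t fun s => prob.P (x t s) (w t s) xs := by
  intro s s' hs
  simp only
  rw [(hrun.dependsOnDraws hprob hτ hmu t).1 s s' hs, hrun.w_nonanticipating t s s' hs]

/-- The initial displacement is zero, and each weight (1 + τ) / p_j is at most 1 / (1 - α). The
Bregman distances then add up to that of the whole sum, so `Lf` enters instead of `∑ j, L j`. -/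
lemma lyapunov_zero_le
    (hrun : prob.IsRPDG p (fun _ => τ) (fun _ => η) (fun _ => α) idx x₀ w₀ x w xt v y yt)
    (hprob : prob.Standing L Lf) (hx₀ : x₀ ∈ prob.X)
    (hw₀ : IsSubgradientWithin prob.X prob.omega x₀ w₀) (hp : ∀ j, 0 < p j)
    (hα1 : α < 1) (hαp : ∀ j, (1 - α) * (1 + τ) ≤ p j) {xs : E} (hxs : xs ∈ prob.X) (s : Ω) :
    lyapunov prob.f p τ η prob.mu xs (fun j => v 0 j s) (x 0 s - x (0 - 1) s)
        (prob.P (x 0 s) (w 0 s) xs) ≤ (prob.mu + η + Lf / (1 - α)) * prob.P x₀ w₀ xs := by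
  have hα : 0 < 1 - α := sub_pos.2 hα1
  have h1 : dualPotential prob.f p τ xs (fun _ => x₀) ≤ 1 / (1 - α) * bregman prob.fsum x₀ xs := by
    rw [hprob.bregman_fsum, Finset.mul_sum]
    refine Finset.sum_le_sum fun j _ => ?_
    refine mul_le_mul_of_nonneg_right ?_
      (bregman_nonneg (hprob.convex_f j) (hprob.differentiable_f j) _ _)
    rw [div_le_div_iff₀ (hp j) hα]
    linarith [hαp j]
  have h2 := bregman_le hprob.differentiable_fsum hprob.lipschitz_fsum x₀ xs
  have h3 := mul_le_mul_of_nonneg_left (hprob.half_sq_le_P hx₀ hxs hw₀) hprob.Lf_nonneg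
  rw [norm_sub_rev] at h2
  have h4 : 1 / (1 - α) * bregman prob.fsum x₀ xs ≤ 1 / (1 - α) * (Lf * prob.P x₀ w₀ xs) :=
    mul_le_mul_of_nonneg_left (by linarith) (by positivity)
  have h5 : 1 / (1 - α) * (Lf * prob.P x₀ w₀ xs) = Lf / (1 - α) * prob.P x₀ w₀ xs := by ring
  simp only [lyapunov, hrun.v_zero, hrun.x_zero, hrun.w_zero, Nat.zero_sub, sub_self, map_zero,
    norm_zero, ne_eq, OfNat.ofNat_ne_zero, not_false_eq_true, zero_pow, mul_zero, add_zero]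
  linarith

variable [MeasurableSpace Ω] {Pr : Measure Ω} [IsProbabilityMeasure Pr]

/-- The master inequality: the weighted expected linearized gaps and the final expected
prox-distance are controlled by the initial prox-distance. -/
lemma expected_weighted_sum_le
    (hrun : prob.IsRPDG p (fun _ => τ) (fun _ => η) (fun _ => α) idx x₀ w₀ x w xt v y yt)
    (hprob : prob.Standing L Lf) (hidx : IsIIDSampling Pr p idx) (hmu : 0 < prob.mu)
    (hx₀ : x₀ ∈ prob.X) (hw₀ : IsSubgradientWithin prob.X prob.omega x₀ w₀) (hp : ∀ j, 0 < p j)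
    (hp1 : ∑ j, p j = 1) (hτ : 0 ≤ τ) (hη : 0 ≤ η) (hα0 : 0 < α) (hα1 : α < 1)
    (hpL : ∀ j, 4 * L j ≤ η * τ * p j) (hηα : η ≤ α * (prob.mu + η))
    (hαp : ∀ j, (1 - α) * (1 + τ) ≤ p j) {xs : E} (hxs : xs ∈ prob.X) (k : ℕ) :
    ∑ t ∈ Finset.Icc 1 k, 1 / α ^ t * ∫ s, prob.linGap xs (x t s) ∂Pr
      + 1 / α ^ k * ((prob.mu + η) * ∫ s, prob.P (x k s) (w k s) xs ∂Pr)
      ≤ (prob.mu + η + Lf / (1 - α)) * prob.P x₀ w₀ xs := by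
  have hmη : 0 < prob.mu + η := by positivity
  have hple : ∀ j, p j ≤ 1 := fun j =>
    hp1 ▸ Finset.single_le_sum (fun j _ => (hp j).le) (Finset.mem_univ j)
  have hdx := fun t => (hrun.dependsOnDraws hprob hτ hmη t).1
  have hdv := fun t => (hrun.dependsOnDraws hprob hτ hmη t).2
  have hdP := hrun.dependsOnDraws_P hprob hτ hmη xs
  have hdx' : ∀ t, DependsOnDraws idx t (x (t - 1)) := fun t => (hdx (t - 1)).mono (Nat.sub_le t 1)
  set U : ℕ → Ω → ℝ := fun t s => lyapunov prob.f p τ η prob.mu xs (fun j => v t j s)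
    (x t s - x (t - 1) s) (prob.P (x t s) (w t s) xs) with hU
  set G : ℕ → Fin m → Ω → ℝ := fun t j s => sampleTerm prob.f p τ α xs (xt (t + 1) s)
    (fun j => v t j s) j ((1 + τ)⁻¹ • (xt (t + 1) s + τ • v t j s)) with hG
  have hdU : ∀ t, DependsOnDraws idx t (U t) := by
    intro t s s' hs
    have hvv : (fun j => v t j s) = fun j => v t j s' := funext fun j => hdv t j s s' hs
    have hPP : prob.P (x t s) (w t s) xs = prob.P (x t s') (w t s') xs := hdP t s s' hs
    simp only [hU]
    rw [hvv, hPP, hdx t s s' hs, hdx' t s s' hs]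
  have hdG : ∀ t j, DependsOnDraws idx t (G t j) := by
    intro t j s s' hs
    have hvv : (fun j => v t j s) = fun j => v t j s' := funext fun j => hdv t j s s' hs
    simp only [hG]
    rw [hvv, hrun.xt_succ, hrun.xt_succ, hdx t s s' hs, hdx' t s s' hs, hdv t j s s' hs]
  have hdG' : ∀ t, DependsOnDraws idx (t + 1) (fun s => G t (idx (t + 1) s) s) := by
    intro t s s' hs
    simp only
    rw [hs (t + 1) (by omega) le_rfl, (hdG t _).mono t.le_succ s s' hs]
  have hdA : ∀ t, DependsOnDraws idx t (fun s => prob.linGap xs (x t s)) := by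
    intro t s s' hs
    simp only
    rw [hdx t s s' hs]
  have hEG : ∀ t, 0 ≤ ∫ s, G t (idx (t + 1) s) s ∂Pr := by
    intro t
    rw [hidx.integral_sampled (hdG t)]
    exact integral_nonneg fun s => sum_sampleTerm_nonneg hprob.convex_f hprob.differentiable_f
      hp hp1 hτ hαp xs (xt (t + 1) s) fun j => v t j s
  have hstep : ∀ t, ∫ s, prob.linGap xs (x (t + 1) s) ∂Pr + ∫ s, U (t + 1) s ∂Pr
      ≤ α * ∫ s, U t s ∂Pr := by
    intro t
    have iA := (hdA (t + 1)).integrable hidx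
    have iG := (hdG' t).integrable hidx
    have iU := (hdU (t + 1)).integrable hidx
    have iAG : Integrable (fun s => prob.linGap xs (x (t + 1) s) + G t (idx (t + 1) s) s) Pr :=
      iA.add iG
    have h1 : ∫ s, (prob.linGap xs (x (t + 1) s) + G t (idx (t + 1) s) s + U (t + 1) s) ∂Pr
        ≤ ∫ s, α * U t s ∂Pr :=
      integral_mono (iAG.add iU) (((hdU t).integrable hidx).const_mul α) fun s =>
        hrun.pathwise_step hprob hx₀ hw₀ hp hple hτ hη hα0.le hα1.le hpL hηα hxs t s
    rw [integral_add iAG iU, integral_add iA iG, integral_const_mul] at h1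
    linarith [hEG t]
  have hsum := weighted_sum_add_le (a := fun t => ∫ s, prob.linGap xs (x t s) ∂Pr)
    (u := fun t => ∫ s, U t s ∂Pr) hα0 hstep k
  have hUk : (prob.mu + η) * ∫ s, prob.P (x k s) (w k s) xs ∂Pr ≤ ∫ s, U k s ∂Pr := by
    rw [← integral_const_mul]
    exact integral_mono (((hdP k).integrable hidx).const_mul _) ((hdU k).integrable hidx) fun s =>
      le_lyapunov hprob.convex_f hprob.differentiable_f hprob.L_nonneg hprob.lipschitz_f hp hp1
        hτ hη hpL xs _ _ _
  have hU0 : ∫ s, U 0 s ∂Pr ≤ (prob.mu + η + Lf / (1 - α)) * prob.P x₀ w₀ xs := by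
    have := integral_mono ((hdU 0).integrable hidx) (integrable_const _)
      (hrun.lyapunov_zero_le hprob hx₀ hw₀ hp hα1 hαp hxs)
    simpa using this
  have := mul_le_mul_of_nonneg_left hUk (show 0 ≤ 1 / α ^ k by positivity)
  linarith

end CompositeProblem.IsRPDG

/-! ### Gap at the ergodic mean -/

section ErgodicMean

variable {E : Type*} [NormedAddCommGroup E] [NormedSpace ℝ E] {m : ℕ} {Ω : Type*}
  {prob : CompositeProblem E m} {L : Fin m → ℝ} {Lf α : ℝ} {x : ℕ → Ω → E}

lemma ergodicMean_eq_centerMass (k : ℕ) (s : Ω) :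
    ergodicMean α x k s = (Finset.Icc 1 k).centerMass (fun t => 1 / α ^ t) fun t => x t s := rfl

lemma sum_weights_pos (hα : 0 < α) {k : ℕ} (hk : 1 ≤ k) :
    0 < ∑ t ∈ Finset.Icc 1 k, 1 / α ^ t :=
  Finset.sum_pos (fun t _ => by positivity) ⟨1, by simp [hk]⟩

lemma ergodicMean_mem {X : Set E} (hX : Convex ℝ X) (hα : 0 < α) {k : ℕ} (hk : 1 ≤ k) {s : Ω}
    (hx : ∀ t, x t s ∈ X) : ergodicMean α x k s ∈ X := by
  rw [ergodicMean_eq_centerMass]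
  exact hX.centerMass_mem (fun t _ => by positivity) (sum_weights_pos hα hk) fun t _ => hx t

lemma CompositeProblem.Standing.Psi_ergodicMean_le (hprob : prob.Standing L Lf) (hmu : 0 < prob.mu)
    (hα : 0 < α) {k : ℕ} (hk : 1 ≤ k) {s : Ω} (hx : ∀ t, x t s ∈ prob.X)
    {w : ℕ → StrongDual ℝ E} (hw : ∀ t, IsSubgradientWithin prob.X prob.omega (x t s) (w t))
    {xs : E} (hxs : xs ∈ prob.X) :
    prob.Psi (ergodicMean α x k s) - prob.Psi xs ≤ (∑ t ∈ Finset.Icc 1 k, 1 / α ^ t)⁻¹ *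
      ∑ t ∈ Finset.Icc 1 k, 1 / α ^ t * (prob.linGap xs (x t s) + Lf * prob.P (x t s) (w t) xs) := by
  have hconv : ConvexOn ℝ prob.X (fun u => prob.linGap xs u + Lf / 2 * ‖u - xs‖ ^ 2) := by
    refine (hprob.convexOn_linGap hmu xs).add (ConvexOn.smul (c := Lf / 2) ?_ ?_)
    · linarith [hprob.Lf_nonneg]
    · have := (convexOn_dist xs hprob.convex).pow (fun u _ => dist_nonneg) 2
      simp only [dist_eq_norm] at this
      exact this
  refine (hprob.Psi_sub_le xs _).trans ?_
  have h1 := hconv.map_centerMass_le (t := Finset.Icc 1 k) (w := fun t => 1 / α ^ t)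
    (p := fun t => x t s) (fun t _ => by positivity) (sum_weights_pos hα hk) fun t _ => hx t
  rw [← ergodicMean_eq_centerMass] at h1
  refine h1.trans ?_
  simp only [Finset.centerMass, smul_eq_mul, Function.comp]
  refine mul_le_mul_of_nonneg_left (Finset.sum_le_sum fun t _ => ?_)
    (inv_nonneg.2 (sum_weights_pos hα hk).le)
  refine mul_le_mul_of_nonneg_left ?_ (by positivity)
  have := mul_le_mul_of_nonneg_left (hprob.half_sq_le_P (hx t) hxs (hw t)) hprob.Lf_nonneg
  rw [norm_sub_rev] at this
  linarith

end ErgodicMean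

/-! ### Expected distance and expected gap -/

namespace CompositeProblem.IsRPDG

variable {E : Type*} [NormedAddCommGroup E] [NormedSpace ℝ E] {m : ℕ}
  {prob : CompositeProblem E m} {L : Fin m → ℝ} {Lf : ℝ}
  {Ω : Type*} {p : Fin m → ℝ} {τ η α : ℝ} {idx : ℕ → Ω → Fin m} {x₀ : E} {w₀ : StrongDual ℝ E}
  {x : ℕ → Ω → E} {w : ℕ → Ω → StrongDual ℝ E} {xt : ℕ → Ω → E}
  {v : ℕ → Fin m → Ω → E} {y yt : ℕ → Fin m → Ω → StrongDual ℝ E}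
  [MeasurableSpace Ω] {Pr : Measure Ω} [IsProbabilityMeasure Pr]

lemma expected_bounds
    (hrun : prob.IsRPDG p (fun _ => τ) (fun _ => η) (fun _ => α) idx x₀ w₀ x w xt v y yt)
    (hprob : prob.Standing L Lf) (hidx : IsIIDSampling Pr p idx) (hmu : 0 < prob.mu)
    (hx₀ : x₀ ∈ prob.X) (hw₀ : IsSubgradientWithin prob.X prob.omega x₀ w₀) (hp : ∀ j, 0 < p j)
    (hp1 : ∑ j, p j = 1) (hτ : 0 ≤ τ) (hη : 0 ≤ η) (hα : 1 / 2 ≤ α) (hα1 : α < 1)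
    (hpL : ∀ j, 4 * L j ≤ η * τ * p j) (hαη : (1 - α) * (prob.mu + η) = prob.mu / 2)
    (hαp : ∀ j, (1 - α) * (1 + τ) ≤ p j) {xs : E} (hxs : prob.IsOptimal xs) (k : ℕ) :
    (Integrable (fun s => prob.P (x k s) (w k s) xs) Pr ∧
      ∫ s, prob.P (x k s) (w k s) xs ∂Pr ≤
        (1 + 2 * Lf / prob.mu) * α ^ k * prob.P x₀ w₀ xs) ∧
    (1 ≤ k → Integrable (fun s => prob.Psi (ergodicMean α x k s) - prob.Psi xs) Pr ∧
      ∫ s, (prob.Psi (ergodicMean α x k s) - prob.Psi xs) ∂Pr ≤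
        α ^ ((k : ℝ) / 2) * (1 - α)⁻¹ * (prob.mu + 2 * Lf + Lf ^ 2 / prob.mu)
          * prob.P x₀ w₀ xs) := by
  have hα0 : 0 < α := by linarith
  have hα' : 0 < 1 - α := sub_pos.2 hα1
  have hmη : 0 < prob.mu + η := by positivity
  have hηα : η ≤ α * (prob.mu + η) := by linarith
  have hLf := hprob.Lf_nonneg
  have hdx := fun t => (hrun.dependsOnDraws hprob hτ hmη t).1
  have iP := fun t => (hrun.dependsOnDraws_P hprob hτ hmη xs t).integrable hidx
  have iA : ∀ t, Integrable (fun s => prob.linGap xs (x t s)) Pr := fun t =>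
    DependsOnDraws.integrable (t := t) hidx fun s s' hs => by
      rw [hdx t s s' hs]
  have hA0 : ∀ t, 0 ≤ ∫ s, prob.linGap xs (x t s) ∂Pr := fun t =>
    integral_nonneg fun s => hprob.linGap_nonneg hmu hxs (hrun.x_mem hx₀ t s)
  have hP0 : ∀ t, 0 ≤ ∫ s, prob.P (x t s) (w t s) xs ∂Pr := fun t =>
    integral_nonneg fun s => P_nonneg hxs.1 (hrun.w_sub hw₀ t s)
  set P₀ := prob.P x₀ w₀ xs with hP₀
  have hP₀0 : 0 ≤ P₀ := P_nonneg hxs.1 hw₀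
  have hmaster := hrun.expected_weighted_sum_le hprob hidx hmu hx₀ hw₀ hp hp1 hτ hη hα0 hα1 hpL hηα
    hαp hxs.1
  -- Since (1 - α)(μ + η) = μ / 2, the factor μ + η can be divided out.
  have hM : (prob.mu + η + Lf / (1 - α)) * P₀ =
      (prob.mu + η) * ((1 + 2 * Lf / prob.mu) * P₀) := by
    have : Lf / (1 - α) = (prob.mu + η) * (2 * Lf / prob.mu) := by
      field_simp
      linear_combination (-2 * Lf) * hαη
    rw [this]
    ring
  have hEP : ∀ t, 1 / α ^ t * ∫ s, prob.P (x t s) (w t s) xs ∂Pr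
      ≤ (1 + 2 * Lf / prob.mu) * P₀ := by
    intro t
    have h1 := hmaster t
    have h2 : 0 ≤ ∑ r ∈ Finset.Icc 1 t, 1 / α ^ r * ∫ s, prob.linGap xs (x r s) ∂Pr :=
      Finset.sum_nonneg fun r _ => mul_nonneg (by positivity) (hA0 r)
    rw [hM] at h1
    refine le_of_mul_le_mul_left ?_ hmη
    linarith
  refine ⟨⟨iP k, ?_⟩, fun hk => ?_⟩
  · have h1 := hEP k
    rw [one_div, inv_mul_le_iff₀ (by positivity)] at h1
    linarith
  have iPsi : Integrable (fun s => prob.Psi (ergodicMean α x k s) - prob.Psi xs) Pr := by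
    refine DependsOnDraws.integrable (t := k) hidx fun s s' hs => ?_
    have : ergodicMean α x k s = ergodicMean α x k s' := by
      unfold ergodicMean
      congr 1
      refine Finset.sum_congr rfl fun t ht => ?_
      rw [(hdx t).mono (Finset.mem_Icc.1 ht).2 s s' hs]
    rw [this]
  refine ⟨iPsi, ?_⟩
  set Θ := ∑ t ∈ Finset.Icc 1 k, 1 / α ^ t with hΘ
  have hΘ0 : 0 < Θ := sum_weights_pos hα0 hk
  have iterm : ∀ t, Integrable
      (fun s => 1 / α ^ t * (prob.linGap xs (x t s) + Lf * prob.P (x t s) (w t s) xs)) Pr :=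
    fun t => ((iA t).add ((iP t).const_mul Lf)).const_mul _
  have h1 : ∫ s, (prob.Psi (ergodicMean α x k s) - prob.Psi xs) ∂Pr ≤
      Θ⁻¹ * ∑ t ∈ Finset.Icc 1 k, 1 / α ^ t * (∫ s, prob.linGap xs (x t s) ∂Pr
        + Lf * ∫ s, prob.P (x t s) (w t s) xs ∂Pr) := by
    have h2 := integral_mono iPsi
      ((integrable_finsetSum (Finset.Icc 1 k) fun t _ => iterm t).const_mul Θ⁻¹) fun s =>
        hprob.Psi_ergodicMean_le hmu hα0 hk (fun t => hrun.x_mem hx₀ t s)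
          (fun t => hrun.w_sub hw₀ t s) hxs.1
    refine h2.trans_eq ?_
    rw [integral_const_mul, integral_finsetSum _ fun t _ => iterm t]
    congr 1
    refine Finset.sum_congr rfl fun t _ => ?_
    rw [integral_const_mul, integral_add (iA t) ((iP t).const_mul Lf), integral_const_mul]
  have h2 : ∑ t ∈ Finset.Icc 1 k, 1 / α ^ t * (∫ s, prob.linGap xs (x t s) ∂Pr
      + Lf * ∫ s, prob.P (x t s) (w t s) xs ∂Pr)
      ≤ (prob.mu + η + Lf / (1 - α)) * P₀ + k * (Lf * ((1 + 2 * Lf / prob.mu) * P₀)) := by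
    simp only [mul_add (1 / α ^ _), Finset.sum_add_distrib]
    refine add_le_add ?_ ?_
    · have h3 := hmaster k
      have h4 : 0 ≤ 1 / α ^ k * ((prob.mu + η) * ∫ s, prob.P (x k s) (w k s) xs ∂Pr) :=
        mul_nonneg (by positivity) (mul_nonneg hmη.le (hP0 k))
      linarith
    · calc _ ≤ ∑ t ∈ Finset.Icc 1 k, Lf * ((1 + 2 * Lf / prob.mu) * P₀) :=
            Finset.sum_le_sum fun t _ => by
              rw [mul_left_comm]
              exact mul_le_mul_of_nonneg_left (hEP t) hLf
        _ = _ := by simp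
  have hk' : (1 : ℝ) ≤ k := by exact_mod_cast hk
  -- As `k ≥ 1`, the constant term of `h2` is multiplied by `k` too, and this one estimate covers
  -- both terms.
  have hkΘ : Θ⁻¹ * k ≤ α ^ ((k : ℝ) / 2) := by
    rw [inv_mul_le_iff₀ hΘ0, mul_comm]
    exact natCast_le_mul_sum hα0 hα1.le k
  have hM0 : 0 ≤ (prob.mu + η + Lf / (1 - α)) * P₀ := by positivity
  have hfin : (prob.mu + η + Lf / (1 - α)) * P₀ + Lf * ((1 + 2 * Lf / prob.mu) * P₀)
      ≤ (1 - α)⁻¹ * (prob.mu + 2 * Lf + Lf ^ 2 / prob.mu) * P₀ := by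
    have e : (prob.mu + η + Lf / (1 - α)) + Lf * (1 + 2 * Lf / prob.mu) =
        (1 - α)⁻¹ * (prob.mu / 2 + Lf + (1 - α) * (Lf + 2 * (Lf ^ 2 / prob.mu))) := by
      rw [← hαη]
      field_simp
    have h3 : (1 - α) * (Lf + 2 * (Lf ^ 2 / prob.mu)) ≤ 1 / 2 * (Lf + 2 * (Lf ^ 2 / prob.mu)) :=
      mul_le_mul_of_nonneg_right (by linarith) (by positivity)
    rw [← mul_assoc, ← add_mul, e]
    refine mul_le_mul_of_nonneg_right (mul_le_mul_of_nonneg_left ?_ (by positivity)) hP₀0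
    linarith
  calc _ ≤ Θ⁻¹ * ((prob.mu + η + Lf / (1 - α)) * P₀
        + k * (Lf * ((1 + 2 * Lf / prob.mu) * P₀))) :=
        h1.trans (mul_le_mul_of_nonneg_left h2 (by positivity))
    _ ≤ Θ⁻¹ * (k * ((prob.mu + η + Lf / (1 - α)) * P₀
        + Lf * ((1 + 2 * Lf / prob.mu) * P₀))) := by
        refine mul_le_mul_of_nonneg_left ?_ (by positivity)
        rw [mul_add]
        linarith [le_mul_of_one_le_left hM0 hk']
    _ = Θ⁻¹ * k * ((prob.mu + η + Lf / (1 - α)) * P₀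
        + Lf * ((1 + 2 * Lf / prob.mu) * P₀)) := by ring
    _ ≤ α ^ ((k : ℝ) / 2) * ((1 - α)⁻¹ * (prob.mu + 2 * Lf + Lf ^ 2 / prob.mu) * P₀) :=
        mul_le_mul hkΘ hfin (by positivity) (by positivity)
    _ = _ := by ring

end CompositeProblem.IsRPDG

/-! ### The theorem for the chosen parameters -/

theorem corollary3p1 {E : Type*} [NormedAddCommGroup E] [NormedSpace ℝ E] [FiniteDimensional ℝ E]
    {m : ℕ} (prob : CompositeProblem E m) (L : Fin m → ℝ) (Lf : ℝ) (hprob : prob.Standing L Lf)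
    (hmu : 0 < prob.mu) (hL : 0 < ∑ i, L i)
    (xs : E) (hxs : prob.IsOptimal xs)
    {Ω : Type*} [MeasurableSpace Ω] (Pr : Measure Ω) [IsProbabilityMeasure Pr]
    (idx : ℕ → Ω → Fin m) (hidx : IsIIDSampling Pr (samplingProb L) idx)
    (C τ η α : ℝ) (hC : C = 8 * (∑ i, L i) / prob.mu)
    (hτ : τ = stepTau m C) (hη : η = stepEta m prob.mu C) (hα : α = stepAlpha m C)
    (x₀ : E) (hx₀ : x₀ ∈ prob.X)
    (w₀ : StrongDual ℝ E) (hw₀ : IsSubgradientWithin prob.X prob.omega x₀ w₀)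
    (x : ℕ → Ω → E) (w : ℕ → Ω → StrongDual ℝ E) (xt : ℕ → Ω → E)
    (v : ℕ → Fin m → Ω → E) (y yt : ℕ → Fin m → Ω → StrongDual ℝ E)
    (hrun : prob.IsRPDG (samplingProb L) (fun _ => τ) (fun _ => η) (fun _ => α) idx x₀ w₀
      x w xt v y yt) :
    -- expected distance and expected optimality gap
    (∀ k : ℕ, 1 ≤ k →
      (Integrable (fun s => prob.P (x k s) (w k s) xs) Pr ∧
        ∫ s, prob.P (x k s) (w k s) xs ∂Pr ≤ (1 + 3 * Lf / prob.mu) * α ^ k * prob.P x₀ w₀ xs) ∧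
      (Integrable (fun s => prob.Psi (ergodicMean α x k s) - prob.Psi xs) Pr ∧
        ∫ s, (prob.Psi (ergodicMean α x k s) - prob.Psi xs) ∂Pr ≤
          α ^ ((k : ℝ) / 2) * (1 - α)⁻¹ * (prob.mu + 2 * Lf + Lf ^ 2 / prob.mu) * prob.P x₀ w₀ xs)) ∧
    -- iteration bounds in terms of the distance to the optimal solution
    (∀ ε : ℝ, 0 < ε → ∀ k : ℕ, iterBound m prob.mu Lf (prob.P x₀ w₀ xs) ε C ≤ k →
      IsStochasticSolution Pr prob.X (x k) (fun s => prob.P (x k s) (w k s) xs) ε) ∧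
    (∀ ε lam : ℝ, 0 < ε → 0 < lam → lam < 1 → ∀ k : ℕ,
      iterBound m prob.mu Lf (prob.P x₀ w₀ xs) (lam * ε) C ≤ k →
      IsStochasticConfidenceSolution Pr prob.X (x k) (fun s => prob.P (x k s) (w k s) xs) ε lam) ∧
    -- iteration bounds in terms of the primal optimality gap
    (∀ ε : ℝ, 0 < ε → ∀ k : ℕ, 1 ≤ k → iterBoundGap m prob.mu Lf (prob.P x₀ w₀ xs) ε C ≤ k →
      IsStochasticSolution Pr prob.X (ergodicMean α x k)
        (fun s => prob.Psi (ergodicMean α x k s) - prob.Psi xs) ε) ∧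
    (∀ ε lam : ℝ, 0 < ε → 0 < lam → lam < 1 → ∀ k : ℕ, 1 ≤ k →
      iterBoundGap m prob.mu Lf (prob.P x₀ w₀ xs) (lam * ε) C ≤ k →
      IsStochasticConfidenceSolution Pr prob.X (ergodicMean α x k)
        (fun s => prob.Psi (ergodicMean α x k s) - prob.Psi xs) ε lam) ∧
    -- both bounds are `O((m + √(m L / μ)) log (1 / ε))` with an absolute constant
    (∀ᶠ ε in 𝓝[>] (0 : ℝ),
      iterBound m prob.mu Lf (prob.P x₀ w₀ xs) ε C ≤
        12 * (m + √(m * (∑ i, L i) / prob.mu)) * Real.log (1 / ε) ∧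
      iterBoundGap m prob.mu Lf (prob.P x₀ w₀ xs) ε C ≤
        24 * (m + √(m * (∑ i, L i) / prob.mu)) * Real.log (1 / ε)) := by
  have hm : 1 ≤ m := by
    rcases Nat.eq_zero_or_pos m with rfl | h
    · simp at hL
    · exact h
  have hm' : (1 : ℝ) ≤ m := by exact_mod_cast hm
  have hC0 : 0 < C := by rw [hC]; positivity
  have hLf := hprob.Lf_nonneg
  have hL0 := hprob.L_nonneg
  have hp : ∀ j, 0 < samplingProb L j := fun j =>
    lt_of_lt_of_le (by positivity) (samplingProb_ge hL0 j)
  have hτ0 : 0 < τ := hτ ▸ stepTau_pos hm hC0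
  have hη0 : 0 < η := hη ▸ stepEta_pos hm hC0 hmu
  have hα' : 0 < 1 - α := hα ▸ one_sub_stepAlpha_pos
  have hα2 : 1 - α ≤ 1 / 2 := hα ▸ one_sub_stepAlpha_le hm
  -- The 8 in `C` is fixed here: η τ = μ C = 8 ∑ L_i and p_j ≥ L_j / (2 ∑ L_i).
  have hpL : ∀ j, 4 * L j ≤ η * τ * samplingProb L j := by
    intro j
    have e : η * τ = 8 * ∑ i, L i := by
      rw [hη, hτ, stepEta_mul_stepTau hm hC0, hC]
      field_simp
    rw [e]
    calc 4 * L j = 8 * (∑ i, L i) * (L j / (2 * ∑ i, L i)) := by field_simp; ring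
      _ ≤ _ := mul_le_mul_of_nonneg_left (div_le_samplingProb j) (by positivity)
  have hbounds := hrun.expected_bounds hprob hidx hmu hx₀ hw₀ hp (sum_samplingProb hm hL) hτ0.le
    hη0.le (by linarith) (by linarith) hpL (by rw [hα, hη, one_sub_stepAlpha_mul_eta])
    (fun j => by rw [hα, hτ, one_sub_stepAlpha_mul_tau hm]; exact samplingProb_ge hL0 j) hxs
  have hα0 : 0 < α := by linarith
  set P₀ := prob.P x₀ w₀ xs with hP₀
  have hP₀0 : 0 ≤ P₀ := CompositeProblem.P_nonneg hxs.1 hw₀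
  set S := ((m : ℝ) + 1) + rootTerm m C with hS
  have hR0 : 0 ≤ rootTerm m C := Real.sqrt_nonneg _
  have hS0 : 0 < S := by positivity
  have hαS : α = 1 - 1 / S := hα
  have hαS' : (1 - α)⁻¹ = S := by rw [hαS]; simp
  have hSle : S ≤ 2 * (m + √(m * C)) := by linarith [rootTerm_le hm hC0.le]
  have hc1 : 0 < 1 + 3 * Lf / prob.mu := by positivity
  have hc2 : 0 < prob.mu + 2 * Lf + Lf ^ 2 / prob.mu := by positivity
  have hc3 : 0 < 2 * (prob.mu + 2 * Lf + Lf ^ 2 / prob.mu) * ((m : ℝ) + √(m * C)) := by positivity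
  have hdist : ∀ k : ℕ, Integrable (fun s => prob.P (x k s) (w k s) xs) Pr ∧
      ∫ s, prob.P (x k s) (w k s) xs ∂Pr ≤ (1 + 3 * Lf / prob.mu) * α ^ k * P₀ := by
    intro k
    refine ⟨(hbounds k).1.1, (hbounds k).1.2.trans ?_⟩
    gcongr
    norm_num
  have hsolP : ∀ ε : ℝ, 0 < ε → ∀ k : ℕ, iterBound m prob.mu Lf P₀ ε C ≤ k →
      IsStochasticSolution Pr prob.X (x k) (fun s => prob.P (x k s) (w k s) xs) ε := by
    intro ε hε k hk
    refine ⟨fun s => hrun.x_mem hx₀ k s, (hdist k).1, (hdist k).2.trans ?_⟩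
    have := pow_mul_le_of_log_le hS0 hα0.le hαS.le hc1 hP₀0 hε (Nat.cast_nonneg k) hk
    rwa [Real.rpow_natCast] at this
  have hsolG : ∀ ε : ℝ, 0 < ε → ∀ k : ℕ, 1 ≤ k → iterBoundGap m prob.mu Lf P₀ ε C ≤ k →
      IsStochasticSolution Pr prob.X (ergodicMean α x k)
        (fun s => prob.Psi (ergodicMean α x k s) - prob.Psi xs) ε := by
    intro ε hε k hk1 hk
    refine ⟨fun s => ergodicMean_mem hprob.convex hα0 hk1 fun t => hrun.x_mem hx₀ t s,
      ((hbounds k).2 hk1).1, ((hbounds k).2 hk1).2.trans ?_⟩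
    have hk' : S * Real.log (2 * (prob.mu + 2 * Lf + Lf ^ 2 / prob.mu) * ((m : ℝ) + √(m * C))
        * (P₀ / ε)) ≤ (k : ℝ) / 2 := by
      unfold iterBoundGap at hk
      linarith
    refine le_trans ?_ (pow_mul_le_of_log_le hS0 hα0.le hαS.le hc3 hP₀0 hε (by positivity) hk')
    refine mul_le_mul_of_nonneg_right ?_ hP₀0
    rw [hαS']
    have h1 := mul_le_mul_of_nonneg_left hSle
      (show 0 ≤ α ^ ((k : ℝ) / 2) * (prob.mu + 2 * Lf + Lf ^ 2 / prob.mu) by positivity)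
    linarith
  have hgap0 : ∀ k : ℕ, 1 ≤ k → ∀ s, 0 ≤ prob.Psi (ergodicMean α x k s) - prob.Psi xs :=
    fun k hk s => sub_nonneg.2 (hxs.2 (ergodicMean_mem hprob.convex hα0 hk fun t =>
      hrun.x_mem hx₀ t s))
  refine ⟨fun k hk => ⟨hdist k, (hbounds k).2 hk⟩, hsolP, ?_, hsolG, ?_, ?_⟩
  · intro ε lam hε hlam _ k hk
    exact (hsolP (lam * ε) (mul_pos hlam hε) k hk).confidence hε fun s =>
      CompositeProblem.P_nonneg hxs.1 (hrun.w_sub hw₀ k s)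
  · intro ε lam hε hlam _ k hk1 hk
    exact (hsolG (lam * ε) (mul_pos hlam hε) k hk1 hk).confidence hε (hgap0 k hk1)
  -- √8 is rounded up to 3, so 2 S ≤ 4 (m + √(m C)) gives the constant 12, and its double gives 24.
  · have hroot : √(m * C) ≤ 3 * √(m * (∑ i, L i) / prob.mu) := by
      have h9 : (3 : ℝ) = √9 := by
        rw [show (9 : ℝ) = 3 ^ 2 by norm_num]
        exact (Real.sqrt_sq (by norm_num)).symm
      rw [h9, ← Real.sqrt_mul (by norm_num)]
      refine Real.sqrt_le_sqrt ?_
      have h1 : (m : ℝ) * C = 8 * (m * (∑ i, L i) / prob.mu) := by rw [hC]; ring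
      have h2 : 0 ≤ m * (∑ i, L i) / prob.mu := by positivity
      linarith
    have hS6 : 2 * S ≤ 12 * (m + √(m * (∑ i, L i) / prob.mu)) := by linarith
    refine (eventually_mul_log_le hS0.le hS6 hc1 hP₀0).and ?_
    exact eventually_mul_log_le (S := 2 * S) (by positivity) (by linarith) hc3 hP₀0
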